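/- Consider the hard-core lattice gas on the square lattice $\mathbb{Z}^2$ (nearest-neighbour adjacency) at activity $\lambda>0$: configurations are independent sets of occupied vertices, and in a finite region $\Lambda$, given the configuration outside $\Lambda$, an admissible set $I\subseteq\Lambda$ of occupied vertices has probability proportional to $\lambda^{|I|}$. An infinite-volume Gibbs measure is a probability measure on the independent sets of $\mathbb{Z}^2$ whose conditional distributions in all finite regions are these finite-volume distributions (the Dobrushin-Lanford-Ruelle equations). Let $$\lambda_c(\mathbb{Z}^2)=\inf\{\lambda>0:\ \text{the hard-core model on } \mathbb{Z}^2 \text{ at activity } \lambda \text{ does not have exactly one infinite-volume Gibbs measure}\}\in[0,\infty].$$ Then $$\lambda_c(\mathbb{Z}^2)>2.48.$$ -/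

import Mathlib

open MeasureTheory
open scoped NNReal ENNReal

noncomputable section

/-- The square lattice `ℤ²`: two points are adjacent when their `ℓ¹` distance is one. -/
def squareLattice : SimpleGraph (ℤ × ℤ) where
  Adj x y := |x.1 - y.1| + |x.2 - y.2| = 1
  symm := ⟨fun x y h => by rw [abs_sub_comm y.1, abs_sub_comm y.2]; exact h⟩
  loopless := ⟨fun x h => by simp at h⟩

variable {V : Type*}

open scoped Classical in
/-- The configurations inside the finite region `Λ` (sets of occupied vertices) that are allowed
by the boundary condition `η`: independent subsets of `Λ`, none of whose vertices is
adjacent to an occupied vertex of `η` outside `Λ`. -/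
def HardCore.allowed (G : SimpleGraph V) (Λ : Finset V) (η : Set V) : Finset (Finset V) :=
  Λ.powerset.filter fun I =>
    G.IsIndepSet (I : Set V) ∧ ∀ v ∈ I, ∀ w ∈ η \ (Λ : Set V), ¬ G.Adj v w

/-- The partition function of the hard-core model in `Λ` with boundary condition `η`. -/
def HardCore.partitionFunction (G : SimpleGraph V) (lam : ℝ≥0) (Λ : Finset V) (η : Set V) :
    ℝ≥0∞ :=
  ∑ I ∈ HardCore.allowed G Λ η, (lam : ℝ≥0∞) ^ I.card

/-- The finite-volume Gibbs distribution at activity `lam` in `Λ` with boundary condition `η`,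
as a measure on configurations of the whole graph: the configuration is kept equal to `η` outside
`Λ`, and inside `Λ` it is `I` with probability proportional to `lam ^ |I|`. -/
def HardCore.finiteGibbs (G : SimpleGraph V) (lam : ℝ≥0) (Λ : Finset V) (η : Set V) :
    Measure (Set V) :=
  (HardCore.partitionFunction G lam Λ η)⁻¹ •
    ∑ I ∈ HardCore.allowed G Λ η,
      (lam : ℝ≥0∞) ^ I.card • Measure.dirac ((I : Set V) ∪ (η \ (Λ : Set V)))

/-- Infinite-volume Gibbs measures of the hard-core model on `G` at activity `lam`: probability
measures on configurations that are concentrated on independent sets and satisfy the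
Dobrushin-Lanford-Ruelle equations for all finite regions. Configurations `Set V` carry the
product sigma-algebra. -/
structure HardCore.IsGibbsMeasure (G : SimpleGraph V) (lam : ℝ≥0) (μ : Measure (Set V)) :
    Prop where
  isProbabilityMeasure : IsProbabilityMeasure μ
  isIndepSet : ∀ᵐ S ∂μ, G.IsIndepSet S
  dlr : ∀ (Λ : Finset V) (A : Set (Set V)), MeasurableSet A →
    μ A = ∫⁻ η, HardCore.finiteGibbs G lam Λ η A ∂μ

/-- Uniqueness at activity `lam`: there is exactly one infinite-volume Gibbs measure. -/
def HardCore.Uniqueness (G : SimpleGraph V) (lam : ℝ≥0) : Prop :=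
  ∃! μ : Measure (Set V), HardCore.IsGibbsMeasure G lam μ

/-- The uniqueness threshold: the infimum, in `[0, ∞]`, of all activities `lam > 0` at which
uniqueness fails. In particular uniqueness holds at every positive activity below it. -/
def HardCore.criticalActivity (G : SimpleGraph V) : ℝ≥0∞ :=
  ⨅ (lam : ℝ≥0) (_ : 0 < lam) (_ : ¬ HardCore.Uniqueness G lam), (lam : ℝ≥0∞)

end

namespace HardCore

variable {V : Type*} {G : SimpleGraph V} {lam : ℝ≥0} {Λ Λ' I J : Finset V} {η σ : Set V}

/-- The configuration that is `I` in `Λ` and `η` outside. -/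
def glue (Λ I : Finset V) (η : Set V) : Set V := (I : Set V) ∪ (η \ (Λ : Set V))

theorem mem_glue {v : V} : v ∈ glue Λ I η ↔ v ∈ I ∨ (v ∈ η ∧ v ∉ Λ) := by
  simp [glue]

theorem mem_allowed : I ∈ allowed G Λ η ↔
    I ⊆ Λ ∧ G.IsIndepSet (I : Set V) ∧ ∀ v ∈ I, ∀ w ∈ η, w ∉ Λ → ¬ G.Adj v w := by
  simp [allowed, and_imp]

theorem empty_mem_allowed : ∅ ∈ allowed G Λ η := by
  simp [mem_allowed, SimpleGraph.IsIndepSet]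

theorem one_le_partitionFunction : 1 ≤ partitionFunction G lam Λ η := by
  have h := Finset.single_le_sum (f := fun I : Finset V => (lam : ℝ≥0∞) ^ I.card)
    (fun _ _ => zero_le) (empty_mem_allowed (G := G) (Λ := Λ) (η := η))
  simpa [partitionFunction] using h

theorem partitionFunction_ne_zero : partitionFunction G lam Λ η ≠ 0 :=
  (lt_of_lt_of_le zero_lt_one one_le_partitionFunction).ne'

theorem partitionFunction_ne_top : partitionFunction G lam Λ η ≠ ∞ := by
  simp [partitionFunction, ENNReal.sum_eq_top]

theorem allowed_congr (h : ∀ v ∉ Λ, v ∈ η ↔ v ∈ σ) : allowed G Λ η = allowed G Λ σ := by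
  ext I
  simp only [mem_allowed]
  refine and_congr_right fun _ => and_congr_right fun _ => ?_
  exact ⟨fun H v hv w hw hwΛ => H v hv w ((h w hwΛ).2 hw) hwΛ,
    fun H v hv w hw hwΛ => H v hv w ((h w hwΛ).1 hw) hwΛ⟩

theorem partitionFunction_congr (h : ∀ v ∉ Λ, v ∈ η ↔ v ∈ σ) :
    partitionFunction G lam Λ η = partitionFunction G lam Λ σ := by
  rw [partitionFunction, partitionFunction, allowed_congr h]

theorem finiteGibbs_apply {A : Set (Set V)} (hA : MeasurableSet A) :
    finiteGibbs G lam Λ η A = (partitionFunction G lam Λ η)⁻¹ *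
      ∑ I ∈ allowed G Λ η, (lam : ℝ≥0∞) ^ I.card * A.indicator 1 (glue Λ I η) := by
  simp [finiteGibbs, Measure.finsetSum_apply, Measure.dirac_apply' _ hA, glue]

theorem lintegral_finiteGibbs {f : Set V → ℝ≥0∞} (hf : Measurable f) :
    ∫⁻ σ, f σ ∂finiteGibbs G lam Λ η = (partitionFunction G lam Λ η)⁻¹ *
      ∑ I ∈ allowed G Λ η, (lam : ℝ≥0∞) ^ I.card * f (glue Λ I η) := by
  simp [finiteGibbs, lintegral_smul_measure, lintegral_dirac' _ hf, glue]

instance : IsProbabilityMeasure (finiteGibbs G lam Λ η) := by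
  refine ⟨?_⟩
  rw [finiteGibbs_apply MeasurableSet.univ]
  simp only [Set.indicator_univ, Pi.one_apply, mul_one]
  exact ENNReal.inv_mul_cancel partitionFunction_ne_zero partitionFunction_ne_top

theorem measurable_mem_allowed [Countable V] (I : Finset V) :
    Measurable fun η : Set V => I ∈ allowed G Λ η := by
  simp only [mem_allowed]
  refine Measurable.and measurable_const (Measurable.and measurable_const ?_)
  refine Measurable.forall fun v => Measurable.imp measurable_const ?_
  refine Measurable.forall fun w => Measurable.imp (measurable_set_mem w) measurable_const

theorem measurable_glue (I : Finset V) : Measurable fun η : Set V => glue Λ I η := by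
  refine measurable_set_iff.2 fun v => ?_
  simp only [mem_glue]
  exact Measurable.or measurable_const (Measurable.and (measurable_set_mem v) measurable_const)

open scoped Classical in
theorem sum_allowed_eq (f : Finset V → ℝ≥0∞) :
    ∑ I ∈ allowed G Λ η, f I = ∑ I ∈ Λ.powerset, if I ∈ allowed G Λ η then f I else 0 := by
  rw [← Finset.sum_filter]
  refine Finset.sum_congr ?_ fun _ _ => rfl
  ext I
  simp only [Finset.mem_filter, Finset.mem_powerset]
  exact ⟨fun h => ⟨(mem_allowed.1 h).1, h⟩, fun h => h.2⟩

theorem measurable_sum_allowed [Countable V] {f : Finset V → Set V → ℝ≥0∞}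
    (hf : ∀ I, Measurable (f I)) :
    Measurable fun η : Set V => ∑ I ∈ allowed G Λ η, f I η := by
  classical
  simp only [sum_allowed_eq]
  refine Finset.measurable_sum _ fun I _ => ?_
  exact Measurable.ite (measurable_mem_allowed I).setOf (hf I) measurable_const

theorem measurable_finiteGibbs_apply [Countable V] {A : Set (Set V)} (hA : MeasurableSet A) :
    Measurable fun η => finiteGibbs G lam Λ η A := by
  simp only [finiteGibbs_apply hA]
  refine Measurable.mul ?_ ?_
  · exact (measurable_sum_allowed fun I => measurable_const).inv
  · exact measurable_sum_allowed fun I =>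
      ((measurable_const.indicator hA).comp (measurable_glue I)).const_mul _

theorem measurable_finiteGibbs [Countable V] :
    Measurable fun η => finiteGibbs G lam Λ η :=
  Measure.measurable_of_measurable_coe _ fun _ hA => measurable_finiteGibbs_apply hA

open scoped Classical in
/-- Resampling a smaller region. -/
theorem union_sdiff_mem_allowed (h : Λ ⊆ Λ') (hI : I ∈ allowed G Λ' η)
    (hJ : J ∈ allowed G Λ (glue Λ' I η)) : J ∪ (I \ Λ) ∈ allowed G Λ' η := by
  rw [mem_allowed] at *
  obtain ⟨hI1, hI2, hI3⟩ := hI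
  obtain ⟨hJ1, hJ2, hJ3⟩ := hJ
  have key : ∀ v ∈ J, ∀ w ∈ I \ Λ, ¬ G.Adj v w := fun v hv w hw =>
    hJ3 v hv w (mem_glue.2 (Or.inl (Finset.mem_sdiff.1 hw).1)) (Finset.mem_sdiff.1 hw).2
  refine ⟨Finset.union_subset (hJ1.trans h) (Finset.sdiff_subset.trans hI1), ?_, ?_⟩
  · intro v hv w hw hvw
    simp only [Finset.coe_union, Set.mem_union, Finset.mem_coe] at hv hw
    rcases hv with hv | hv <;> rcases hw with hw | hw
    · exact hJ2 hv hw hvw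
    · exact key v hv w hw
    · exact fun hadj => key w hw v hv hadj.symm
    · exact hI2 (Finset.mem_sdiff.1 hv).1 (Finset.mem_sdiff.1 hw).1 hvw
  · intro v hv w hw hwΛ
    rcases Finset.mem_union.1 hv with hv | hv
    · exact hJ3 v hv w (mem_glue.2 (Or.inr ⟨hw, hwΛ⟩)) fun hh => hwΛ (h hh)
    · exact hI3 v (Finset.mem_sdiff.1 hv).1 w hw hwΛ

open scoped Classical in
theorem inter_mem_allowed (hI : I ∈ allowed G Λ' η)
    (hJ : J ∈ allowed G Λ (glue Λ' I η)) :
    I ∩ Λ ∈ allowed G Λ (glue Λ' (J ∪ (I \ Λ)) η) := by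
  rw [mem_allowed] at *
  obtain ⟨hI1, hI2, hI3⟩ := hI
  refine ⟨Finset.inter_subset_right, ?_, ?_⟩
  · intro v hv w hw hvw
    simp only [Finset.coe_inter, Set.mem_inter_iff, Finset.mem_coe] at hv hw
    exact hI2 hv.1 hw.1 hvw
  · intro v hv w hw hwΛ
    have hv := Finset.mem_inter.1 hv
    rcases mem_glue.1 hw with hw | ⟨hw, hwΛ'⟩
    · rcases Finset.mem_union.1 hw with hw | hw
      · exact absurd (hJ.1 hw) hwΛ
      · have hw := (Finset.mem_sdiff.1 hw).1
        rcases eq_or_ne v w with rfl | hvw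
        · exact absurd hv.2 hwΛ
        · exact hI2 hv.1 hw hvw
    · exact hI3 v hv.1 w hw hwΛ'

open scoped Classical in
theorem glue_glue (h : Λ ⊆ Λ') :
    glue Λ J (glue Λ' I η) = glue Λ' (J ∪ (I \ Λ)) η := by
  ext v
  simp only [mem_glue, Finset.mem_union, Finset.mem_sdiff]
  have := @h v
  tauto

/-- Consistency of the finite-volume Gibbs distributions. -/
theorem lintegral_finiteGibbs_finiteGibbs [Countable V] (h : Λ ⊆ Λ') {A : Set (Set V)}
    (hA : MeasurableSet A) :
    ∫⁻ σ, finiteGibbs G lam Λ σ A ∂finiteGibbs G lam Λ' η = finiteGibbs G lam Λ' η A := by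
  classical
  rw [lintegral_finiteGibbs (measurable_finiteGibbs_apply hA), finiteGibbs_apply hA]
  congr 1
  set Z : Finset V → ℝ≥0∞ := fun I => partitionFunction G lam Λ (glue Λ' I η) with hZ
  have hZcongr : ∀ I J, J ∈ allowed G Λ (glue Λ' I η) → Z (J ∪ (I \ Λ)) = Z I := by
    intro I J hJ
    refine partitionFunction_congr fun v hv => ?_
    have := @(mem_allowed.1 hJ).1 v
    simp only [mem_glue, Finset.mem_union, Finset.mem_sdiff]
    tauto
  have hL : ∀ I ∈ allowed G Λ' η,
      (lam : ℝ≥0∞) ^ I.card * finiteGibbs G lam Λ (glue Λ' I η) A =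
      ∑ J ∈ allowed G Λ (glue Λ' I η), (Z I)⁻¹ * ((lam : ℝ≥0∞) ^ I.card *
        (lam : ℝ≥0∞) ^ J.card) * A.indicator 1 (glue Λ' (J ∪ (I \ Λ)) η) := by
    intro I _
    rw [finiteGibbs_apply hA, Finset.mul_sum, Finset.mul_sum]
    refine Finset.sum_congr rfl fun J _ => ?_
    rw [glue_glue h]
    ring
  have hR : ∀ I ∈ allowed G Λ' η,
      (lam : ℝ≥0∞) ^ I.card * A.indicator 1 (glue Λ' I η) =
      ∑ J ∈ allowed G Λ (glue Λ' I η), (Z I)⁻¹ * ((lam : ℝ≥0∞) ^ I.card *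
        (lam : ℝ≥0∞) ^ J.card) * A.indicator 1 (glue Λ' I η) := by
    intro I _
    rw [← Finset.sum_mul, ← Finset.mul_sum, ← Finset.mul_sum]
    have : (Z I)⁻¹ * ((lam : ℝ≥0∞) ^ I.card *
        ∑ J ∈ allowed G Λ (glue Λ' I η), (lam : ℝ≥0∞) ^ J.card) = (lam : ℝ≥0∞) ^ I.card := by
      rw [mul_left_comm]
      change _ * ((Z I)⁻¹ * Z I) = _
      rw [ENNReal.inv_mul_cancel partitionFunction_ne_zero partitionFunction_ne_top, mul_one]
    rw [this]
  rw [Finset.sum_congr rfl hL, Finset.sum_congr rfl hR, Finset.sum_sigma', Finset.sum_sigma']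
  have e1 : ∀ I J : Finset V, (I ∩ Λ) ∪ ((J ∪ (I \ Λ)) \ Λ) = I ∪ (J \ Λ) := by
    intro I J; ext v; simp only [Finset.mem_union, Finset.mem_inter, Finset.mem_sdiff]; tauto
  have e2 : ∀ I J : Finset V, J ⊆ Λ → (J ∪ (I \ Λ)) ∩ Λ = J := by
    intro I J hJ; ext v
    have := @hJ v
    simp only [Finset.mem_union, Finset.mem_inter, Finset.mem_sdiff]; tauto
  have e3 : ∀ I J : Finset V, J ⊆ Λ → (I ∩ Λ) ∪ ((J ∪ (I \ Λ)) \ Λ) = I := by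
    intro I J hJ; rw [e1, Finset.sdiff_eq_empty_iff_subset.2 hJ, Finset.union_empty]
  refine Finset.sum_bij' (fun p _ => ⟨p.2 ∪ (p.1 \ Λ), p.1 ∩ Λ⟩)
    (fun p _ => ⟨p.2 ∪ (p.1 \ Λ), p.1 ∩ Λ⟩) ?_ ?_ ?_ ?_ ?_
  · rintro ⟨I, J⟩ hp
    rw [Finset.mem_sigma] at hp ⊢
    exact ⟨union_sdiff_mem_allowed h hp.1 hp.2, inter_mem_allowed hp.1 hp.2⟩
  · rintro ⟨I, J⟩ hp
    rw [Finset.mem_sigma] at hp ⊢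
    exact ⟨union_sdiff_mem_allowed h hp.1 hp.2, inter_mem_allowed hp.1 hp.2⟩
  · rintro ⟨I, J⟩ hp
    have hJ := (mem_allowed.1 (Finset.mem_sigma.1 hp).2).1
    simp only [e3 I J hJ, e2 I J hJ]
  · rintro ⟨I, J⟩ hp
    have hJ := (mem_allowed.1 (Finset.mem_sigma.1 hp).2).1
    simp only [e3 I J hJ, e2 I J hJ]
  · rintro ⟨I, J⟩ hp
    have hJ := (Finset.mem_sigma.1 hp).2
    have hJΛ := (mem_allowed.1 hJ).1
    have hcard : I.card + J.card = (J ∪ (I \ Λ)).card + (I ∩ Λ).card := by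
      rw [Finset.card_union_of_disjoint, add_assoc, Finset.card_sdiff_add_card_inter, add_comm]
      exact Finset.disjoint_left.2 fun v hv hv' => (Finset.mem_sdiff.1 hv').2 (hJΛ hv)
    simp only [hZcongr I J hJ, ← pow_add, hcard]

end HardCore

namespace HardCore

open Filter Topology
open scoped BoundedContinuousFunction

variable {V : Type*} {G : SimpleGraph V} {lam : ℝ≥0}

/-- The event that no vertex of `F` is occupied. -/
def avoid (F : Finset V) : Set (Set V) := {S | ∀ v ∈ F, v ∉ S}

theorem mem_avoid {F : Finset V} {S : Set V} : S ∈ avoid F ↔ ∀ v ∈ F, v ∉ S := Iff.rfl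

theorem measurableSet_avoid (F : Finset V) : MeasurableSet (avoid F) := by
  have : avoid F = ⋂ v ∈ F, {S : Set V | v ∉ S} := by
    ext S; simp [mem_avoid]
  rw [this]
  exact Finset.measurableSet_biInter _ fun v _ => (measurable_set_notMem v).setOf

theorem isPiSystem_avoid : IsPiSystem (Set.range (avoid (V := V))) := by
  classical
  rintro _ ⟨F, rfl⟩ _ ⟨F', rfl⟩ _
  refine ⟨F ∪ F', ?_⟩
  ext S
  simp only [Set.mem_inter_iff, mem_avoid, Finset.mem_union]
  exact ⟨fun h => ⟨fun v hv => h v (Or.inl hv), fun v hv => h v (Or.inr hv)⟩,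
    fun h v hv => hv.elim (h.1 v) (h.2 v)⟩

theorem generateFrom_avoid :
    (inferInstance : MeasurableSpace (Set V)) =
      MeasurableSpace.generateFrom (Set.range (avoid (V := V))) := by
  refine le_antisymm ?_ (MeasurableSpace.generateFrom_le ?_)
  · have h : @Measurable _ _ (MeasurableSpace.generateFrom (Set.range (avoid (V := V)))) _
        (id : Set V → Set V) := by
      refine (@measurable_set_iff V (Set V)
        (MeasurableSpace.generateFrom (Set.range (avoid (V := V)))) id).2 fun v => ?_
      refine (@measurableSet_setOfPred (Set V)
        (MeasurableSpace.generateFrom (Set.range (avoid (V := V)))) _).1 ?_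
      have : {S : Set V | v ∈ id S} = (avoid {v})ᶜ := by
        ext S; simp [mem_avoid]
      rw [this]
      exact MeasurableSet.compl (MeasurableSpace.measurableSet_generateFrom
        (s := Set.range (avoid (V := V))) (Set.mem_range_self ({v} : Finset V)))
    intro s hs
    exact h hs
  · rintro _ ⟨F, rfl⟩
    exact measurableSet_avoid F

theorem measure_ext_avoid {μ ν : Measure (Set V)} [IsFiniteMeasure μ]
    (h : ∀ F, μ (avoid F) = ν (avoid F)) : μ = ν := by
  refine ext_of_generate_finite _ generateFrom_avoid isPiSystem_avoid ?_ ?_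
  · rintro _ ⟨F, rfl⟩
    exact h F
  · have : (Set.univ : Set (Set V)) = avoid ∅ := by
      ext S; simp [mem_avoid]
    rw [this]
    exact h ∅

theorem allowed_congr_of_adj {Λ : Finset V} {η σ : Set V}
    (h : ∀ v ∈ Λ, ∀ w ∉ Λ, G.Adj v w → (w ∈ η ↔ w ∈ σ)) :
    allowed G Λ η = allowed G Λ σ := by
  ext I
  simp only [mem_allowed]
  refine and_congr_right fun hI => and_congr_right fun _ => ?_
  exact ⟨fun H v hv w hw hwΛ hvw => H v hv w ((h v (hI hv) w hwΛ hvw).2 hw) hwΛ hvw,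
    fun H v hv w hw hwΛ hvw => H v hv w ((h v (hI hv) w hwΛ hvw).1 hw) hwΛ hvw⟩

theorem finiteGibbs_avoid_congr {Λ F : Finset V} {η σ : Set V}
    (h : ∀ v ∈ Λ, ∀ w ∉ Λ, G.Adj v w → (w ∈ η ↔ w ∈ σ)) (hF : ∀ v ∈ F, v ∈ η ↔ v ∈ σ) :
    finiteGibbs G lam Λ η (avoid F) = finiteGibbs G lam Λ σ (avoid F) := by
  classical
  rw [finiteGibbs_apply (measurableSet_avoid F), finiteGibbs_apply (measurableSet_avoid F),
    partitionFunction, partitionFunction, allowed_congr_of_adj h]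
  congr 1
  refine Finset.sum_congr rfl fun I _ => ?_
  congr 1
  have : glue Λ I η ∈ avoid F ↔ glue Λ I σ ∈ avoid F := by
    simp only [mem_avoid, mem_glue]
    exact forall₂_congr fun v hv => by rw [hF v hv]
  simp only [Set.indicator_apply, this, Pi.one_apply]

/-- Convergence of integrals of local observables along a subnet of any net of probability
measures. -/
theorem exists_limit_measure [Countable V] {ι : Type*} (l : Filter ι) [l.NeBot]
    (γ : ι → Measure (Set V)) [∀ i, IsProbabilityMeasure (γ i)] :
    ∃ (U : Filter ι) (μ : Measure (Set V)), U ≤ l ∧ U.NeBot ∧ IsProbabilityMeasure μ ∧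
      ∀ (f : Set V → ℝ≥0∞) (K : Finset V), (∀ S, f S ≤ 1) →
        (∀ S S' : Set V, (∀ v ∈ K, v ∈ S ↔ v ∈ S') → f S = f S') →
        Tendsto (fun i => ∫⁻ S, f S ∂γ i) U (𝓝 (∫⁻ S, f S ∂μ)) := by
  classical
  set e : Set V → (V → Bool) := fun S v => decide (v ∈ S) with he
  set b : (V → Bool) → Set V := fun x => {v | x v = true} with hb
  have hem : Measurable e := measurable_pi_iff.2 fun v =>
    (Measurable.of_discrete (f := fun p : Prop => decide p)).comp (measurable_set_mem v)
  have hbm : Measurable b := measurable_set_iff.2 fun v =>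
    (Measurable.of_discrete (f := fun p : Bool => p = true)).comp (measurable_pi_apply v)
  have hbe : ∀ S, b (e S) = S := fun S => by ext v; simp [hb, he]
  set m : ι → ProbabilityMeasure (V → Bool) := fun i =>
    ⟨(γ i).map e, Measure.isProbabilityMeasure_map hem.aemeasurable⟩ with hm
  obtain ⟨ν, -, hν⟩ := (isCompact_univ (X := ProbabilityMeasure (V → Bool))).ultrafilter_le_nhds
    ((Ultrafilter.of l).map m) (by simp)
  refine ⟨Ultrafilter.of l, (ν : Measure (V → Bool)).map b, Ultrafilter.of_le l, inferInstance,
    Measure.isProbabilityMeasure_map hbm.aemeasurable, ?_⟩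
  intro f K hf1 hfK
  have hcont : Continuous fun x : V → Bool => f (b x) := by
    have hfac : (fun x : V → Bool => f (b x)) =
        (fun y : K → Bool => f {v | ∃ h : v ∈ K, y ⟨v, h⟩ = true}) ∘
          fun x k => x k := by
      funext x
      refine hfK _ _ fun v hv => ?_
      simp [hb, hv]
    rw [hfac]
    exact continuous_of_discreteTopology.comp (continuous_pi fun k => continuous_apply _)
  have hfm : Measurable f := by
    have : f = (fun x => f (b x)) ∘ e := by
      funext S; simp [hbe]
    rw [this]
    exact hcont.measurable.comp hem
  have hne : ∀ S, f S ≠ ∞ := fun S => ne_top_of_le_ne_top ENNReal.one_ne_top (hf1 S)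
  have hcont' : Continuous fun x : V → Bool => (f (b x)).toNNReal :=
    ENNReal.continuousOn_toNNReal.comp_continuous hcont fun x => hne _
  let g : (V → Bool) →ᵇ ℝ≥0 := BoundedContinuousFunction.mkOfCompact ⟨_, hcont'⟩
  have hg : ∀ x, ((g x : ℝ≥0) : ℝ≥0∞) = f (b x) := fun x => ENNReal.coe_toNNReal (hne _)
  have hconv := (ProbabilityMeasure.tendsto_iff_forall_lintegral_tendsto
    (μs := m) (F := (Ultrafilter.of l : Filter ι)) (μ := ν)).1 hν g
  simp only [hg] at hconv
  rw [lintegral_map hfm hbm]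
  refine hconv.congr fun i => ?_
  change ∫⁻ ω, f (b ω) ∂((γ i).map e) = _
  rw [lintegral_map (f := fun ω => f (b ω)) (hfm.comp hbm) hem]
  simp only [hbe]

theorem exists_isGibbsMeasure [Countable V] (hG : ∀ v, (G.neighborSet v).Finite) (lam : ℝ≥0) :
    ∃ μ, IsGibbsMeasure G lam μ := by
  classical
  obtain ⟨U, μ, hU, hne, hμ, hconv⟩ :=
    exists_limit_measure (atTop : Filter (Finset V)) fun Λ => finiteGibbs G lam Λ ∅
  have hdlr : ∀ Λ : Finset V, μ = μ.bind fun η => finiteGibbs G lam Λ η := by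
    intro Λ
    have hmeas : Measurable fun η => finiteGibbs G lam Λ η := measurable_finiteGibbs
    refine measure_ext_avoid fun F => ?_
    rw [Measure.bind_apply (measurableSet_avoid F) hmeas.aemeasurable]
    have h1 := hconv ((avoid F).indicator 1) F
      (fun S => Set.indicator_le_self' (fun _ _ => zero_le) S) (by
        intro S S' h
        have : S ∈ avoid F ↔ S' ∈ avoid F := by
          simp only [mem_avoid]
          exact forall₂_congr fun v hv => by rw [h v hv]
        simp only [Set.indicator_apply, this, Pi.one_apply])
    have h2 := hconv (fun η => finiteGibbs G lam Λ η (avoid F))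
      (F ∪ Λ.biUnion fun v => (hG v).toFinset) (fun S => prob_le_one) (by
        intro S S' h
        refine finiteGibbs_avoid_congr (fun v hv w _ hvw => h w ?_) fun v hv => h v ?_
        · exact Finset.mem_union_right _ (Finset.mem_biUnion.2 ⟨v, hv, by simpa using hvw⟩)
        · exact Finset.mem_union_left _ hv)
    simp only [lintegral_indicator_one (measurableSet_avoid F)] at h1
    refine tendsto_nhds_unique h1 (h2.congr' ?_)
    filter_upwards [hU (Ici_mem_atTop Λ)] with Λ' hΛ'
    exact lintegral_finiteGibbs_finiteGibbs hΛ' (measurableSet_avoid F)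
  have hdlr' : ∀ (Λ : Finset V) (A : Set (Set V)), MeasurableSet A →
      μ A = ∫⁻ η, finiteGibbs G lam Λ η A ∂μ := by
    intro Λ A hA
    conv_lhs => rw [hdlr Λ]
    rw [Measure.bind_apply hA measurable_finiteGibbs.aemeasurable]
  refine ⟨μ, hμ, ?_, hdlr'⟩
  have hpair : ∀ v w, G.Adj v w → ∀ᵐ S ∂μ, ¬ (v ∈ S ∧ w ∈ S) := by
    intro v w hvw
    rw [ae_iff]
    have hA : MeasurableSet {S : Set V | ¬¬ (v ∈ S ∧ w ∈ S)} :=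
      (((measurable_set_mem v).and (measurable_set_mem w)).not.not).setOf
    rw [hdlr' {v, w} _ hA]
    refine (lintegral_congr fun η => ?_).trans lintegral_zero
    rw [finiteGibbs_apply hA, Finset.sum_eq_zero, mul_zero]
    intro I hI
    rw [Set.indicator_of_notMem, mul_zero]
    simp only [Set.mem_ofPred_eq, not_not, mem_glue, Finset.mem_insert, Finset.mem_singleton,
      true_or, or_true, not_true, and_false, or_false]
    exact fun h => (mem_allowed.1 hI).2.1 h.1 h.2 hvw.ne hvw
  have hall : ∀ᵐ S ∂μ, ∀ v w, G.Adj v w → ¬ (v ∈ S ∧ w ∈ S) := by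
    rw [ae_all_iff]; intro v
    rw [ae_all_iff]; intro w
    by_cases hvw : G.Adj v w
    · filter_upwards [hpair v w hvw] with S hS _ using hS
    · exact Eventually.of_forall fun S h => absurd h hvw
  filter_upwards [hall] with S hS
  exact fun v hv w hw _ hvw => hS v w hvw ⟨hv, hw⟩

/-- Uniqueness follows when the influence of the boundary condition on the probability that a
finite set is empty vanishes. -/
theorem uniqueness_of_forall_exists [Countable V] (hG : ∀ v, (G.neighborSet v).Finite)
    (h : ∀ (F : Finset V) (ε : ℝ≥0∞), 0 < ε → ∃ Λ : Finset V, ∀ η σ : Set V,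
      finiteGibbs G lam Λ η (avoid F) ≤ finiteGibbs G lam Λ σ (avoid F) + ε) :
    Uniqueness G lam := by
  obtain ⟨μ, hμ⟩ := exists_isGibbsMeasure hG lam
  have hle : ∀ μ ν : Measure (Set V), IsGibbsMeasure G lam μ → IsGibbsMeasure G lam ν →
      ∀ F, μ (avoid F) ≤ ν (avoid F) := by
    intro μ ν hμ hν F
    have := hμ.isProbabilityMeasure
    have := hν.isProbabilityMeasure
    refine ENNReal.le_of_forall_pos_le_add fun ε hε _ => ?_
    obtain ⟨Λ, hΛ⟩ := h F ε (by exact_mod_cast hε)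
    rw [hμ.dlr Λ _ (measurableSet_avoid F), hν.dlr Λ _ (measurableSet_avoid F)]
    have hσ : ∀ σ, ∫⁻ η, finiteGibbs G lam Λ η (avoid F) ∂μ ≤
        finiteGibbs G lam Λ σ (avoid F) + ε := by
      intro σ
      calc ∫⁻ η, finiteGibbs G lam Λ η (avoid F) ∂μ
          ≤ ∫⁻ _, (finiteGibbs G lam Λ σ (avoid F) + ε) ∂μ := lintegral_mono fun η => hΛ η σ
        _ = _ := by simp
    calc ∫⁻ η, finiteGibbs G lam Λ η (avoid F) ∂μ
        = ∫⁻ _, (∫⁻ η, finiteGibbs G lam Λ η (avoid F) ∂μ) ∂ν := by simp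
      _ ≤ ∫⁻ σ, (finiteGibbs G lam Λ σ (avoid F) + ε) ∂ν := lintegral_mono hσ
      _ = _ := by rw [lintegral_add_right _ measurable_const]; simp
  refine ⟨μ, hμ, fun ν hν => ?_⟩
  have := hν.isProbabilityMeasure
  exact measure_ext_avoid fun F => le_antisymm (hle ν μ hν hμ F) (hle μ ν hμ hν F)

end HardCore

namespace HardCore

variable {V : Type*} {G : SimpleGraph V} {lam : ℝ} {A B : Finset V} {u v : V}

open scoped Classical in
/-- The partition function of the subgraph induced on a finite set. -/
noncomputable def Z (G : SimpleGraph V) (lam : ℝ) (A : Finset V) : ℝ :=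
  ∑ I ∈ A.powerset.filter fun I : Finset V => G.IsIndepSet (I : Set V), lam ^ I.card

theorem Z_pos (hlam : 0 ≤ lam) (A : Finset V) : 0 < Z G lam A := by
  classical
  refine Finset.sum_pos' (fun I _ => pow_nonneg hlam _) ⟨∅, ?_, by simp⟩
  simp [SimpleGraph.IsIndepSet]

theorem Z_eq_add [DecidableEq V] (hu : u ∈ A)
    (hB : ∀ w, w ∈ B ↔ w ∈ A ∧ w ≠ u ∧ ¬ G.Adj u w) :
    Z G lam A = Z G lam (A.erase u) + lam * Z G lam B := by
  classical
  unfold Z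
  rw [← Finset.sum_filter_not_add_sum_filter _ (fun I : Finset V => u ∈ I)]
  congr 1
  · refine Finset.sum_congr ?_ fun _ _ => rfl
    ext I
    simp only [Finset.mem_filter, Finset.mem_powerset, Finset.subset_erase]
    tauto
  · rw [Finset.mul_sum]
    refine Finset.sum_bij' (fun I _ => I.erase u) (fun I _ => insert u I) ?_ ?_ ?_ ?_ ?_
    · intro I hI
      simp only [Finset.mem_filter, Finset.mem_powerset] at hI ⊢
      obtain ⟨⟨hIA, hI⟩, huI⟩ := hI
      refine ⟨fun w hw => ?_, fun w hw x hx => ?_⟩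
      · have hw := Finset.mem_erase.1 hw
        exact (hB w).2 ⟨hIA hw.2, hw.1, hI huI hw.2 hw.1.symm⟩
      · exact hI (Finset.mem_of_mem_erase hw) (Finset.mem_of_mem_erase hx)
    · intro I hI
      simp only [Finset.mem_filter, Finset.mem_powerset] at hI ⊢
      refine ⟨⟨Finset.insert_subset hu fun w hw => ((hB w).1 (hI.1 hw)).1, ?_⟩,
        Finset.mem_insert_self _ _⟩
      intro w hw x hx hwx
      simp only [Finset.coe_insert, Set.mem_insert_iff, Finset.mem_coe] at hw hx
      rcases hw with rfl | hw <;> rcases hx with rfl | hx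
      · exact absurd rfl hwx
      · exact ((hB x).1 (hI.1 hx)).2.2
      · exact fun h => ((hB w).1 (hI.1 hw)).2.2 h.symm
      · exact hI.2 hw hx hwx
    · intro I hI
      simp only [Finset.mem_filter] at hI
      exact Finset.insert_erase hI.2
    · intro I hI
      simp only [Finset.mem_filter, Finset.mem_powerset] at hI
      exact Finset.erase_insert fun h => ((hB u).1 (hI.1 h)).2.1 rfl
    · intro I hI
      simp only [Finset.mem_filter] at hI
      rw [← pow_succ', Finset.card_erase_add_one hI.2]

/-- The inverse of the probability that `v` is vacant in the hard-core model on `A`. -/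
noncomputable def invVacancy [DecidableEq V] (G : SimpleGraph V) (lam : ℝ) (A : Finset V) (v : V) : ℝ :=
  Z G lam A / Z G lam (A.erase v)

theorem Z_erase_le [DecidableEq V] (hlam : 0 ≤ lam) : Z G lam (A.erase v) ≤ Z G lam A := by
  classical
  by_cases hv : v ∈ A
  · rw [Z_eq_add (B := A.filter fun w => w ≠ v ∧ ¬ G.Adj v w) hv fun w => Finset.mem_filter]
    exact le_add_of_nonneg_right (mul_nonneg hlam (Z_pos hlam _).le)
  · rw [Finset.erase_eq_of_notMem hv]

theorem one_le_invVacancy [DecidableEq V] (hlam : 0 ≤ lam) : 1 ≤ invVacancy G lam A v :=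
  (one_le_div (Z_pos hlam _)).2 (Z_erase_le hlam)

/-- The occupation odds in the coordinate in which the tree recursion contracts:
the square of its hyperbolic sine is the ratio of occupation and vacancy probability of `v`. -/
noncomputable def angle [DecidableEq V] (G : SimpleGraph V) (lam : ℝ) (A : Finset V) (v : V) : ℝ :=
  Real.arsinh √(invVacancy G lam A v - 1)

theorem angle_nonneg [DecidableEq V] : 0 ≤ angle G lam A v :=
  Real.arsinh_nonneg_iff.2 (Real.sqrt_nonneg _)

theorem cosh_angle_sq [DecidableEq V] (hlam : 0 ≤ lam) :
    Real.cosh (angle G lam A v) ^ 2 = invVacancy G lam A v := by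
  rw [Real.cosh_sq, angle, Real.sinh_arsinh,
    Real.sq_sqrt (sub_nonneg.2 (one_le_invVacancy hlam)), sub_add_cancel]

theorem angle_of_notMem [DecidableEq V] (hlam : 0 ≤ lam) (hv : v ∉ A) :
    angle G lam A v = 0 := by
  rw [angle, invVacancy, Finset.erase_eq_of_notMem hv, div_self (Z_pos hlam _).ne']
  simp

theorem Z_eq_mul_prod [DecidableEq V] (hlam : 0 ≤ lam) (us : List V) (B : Finset V) :
    Z G lam B = Z G lam (B \ us.toFinset) *
      ∏ i : Fin us.length, invVacancy G lam (B \ (us.take i).toFinset) us[i] := by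
  induction us generalizing B with
  | nil => simp
  | cons u us ih =>
    have hB : ∀ l : List V, B.erase u \ l.toFinset = B \ (u :: l).toFinset := by
      intro l; ext w; simp only [Finset.mem_sdiff, Finset.mem_erase, List.mem_toFinset,
        List.mem_cons]; tauto
    have := ih (B.erase u)
    simp only [hB] at this
    simp only [List.length_cons, Fin.prod_univ_succ]
    simp only [Fin.val_zero, List.take_zero, List.toFinset_nil, Finset.sdiff_empty,
      Fin.val_succ, List.take_succ_cons, Fin.getElem_fin, List.getElem_cons_zero,
      List.getElem_cons_succ] at this ⊢
    rw [mul_left_comm, ← this, invVacancy, div_mul_cancel₀ _ (Z_pos hlam _).ne']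

/-- The tree recursion: the neighbours of `v` are removed one after the other. -/
theorem sinh_angle [DecidableEq V] (hlam : 0 ≤ lam) (hv : v ∈ A) (us : List V)
    (hus : ∀ u ∈ us, G.Adj v u) (hus' : ∀ u ∈ A, G.Adj v u → u ∈ us) :
    Real.sinh (angle G lam A v) = √lam / ∏ i : Fin us.length,
      Real.cosh (angle G lam (A.erase v \ (us.take i).toFinset) us[i]) := by
  have h1 : Z G lam A = Z G lam (A.erase v) + lam * Z G lam (A.erase v \ us.toFinset) := by
    refine Z_eq_add hv fun w => ?_
    simp only [Finset.mem_sdiff, Finset.mem_erase, List.mem_toFinset]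
    constructor
    · rintro ⟨⟨h1, h2⟩, h3⟩
      exact ⟨h2, h1, fun h => h3 (hus' w h2 h)⟩
    · rintro ⟨h1, h2, h3⟩
      exact ⟨⟨h2, h1⟩, fun h => h3 (hus w h)⟩
  have h2 := Z_eq_mul_prod (G := G) hlam us (A.erase v)
  have hP : 0 < ∏ i : Fin us.length,
      Real.cosh (angle G lam (A.erase v \ (us.take i).toFinset) us[i]) :=
    Finset.prod_pos fun i _ => Real.cosh_pos _
  simp only [← cosh_angle_sq hlam, Finset.prod_pow] at h2
  have hZ := Z_pos (G := G) hlam (A.erase v)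
  have hZ' := Z_pos (G := G) hlam (A.erase v \ us.toFinset)
  rw [angle, Real.sinh_arsinh, invVacancy, h1, add_div, div_self hZ.ne', add_sub_cancel_left,
    h2, mul_comm lam, mul_div_mul_left _ _ hZ'.ne', Real.sqrt_div hlam, Real.sqrt_sq hP.le]

theorem angle_le [DecidableEq V] (hlam : 0 ≤ lam) : angle G lam A v ≤ Real.arsinh √lam := by
  classical
  by_cases hv : v ∈ A
  · set us := (A.filter fun w => G.Adj v w).toList
    have h := sinh_angle (G := G) hlam hv us (fun u hu => by simpa [us] using
      (Finset.mem_filter.1 (Finset.mem_toList.1 hu)).2)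
      (fun u hu huv => Finset.mem_toList.2 (Finset.mem_filter.2 ⟨hu, huv⟩))
    rw [← Real.sinh_le_sinh, h, Real.sinh_arsinh]
    refine div_le_self (Real.sqrt_nonneg _) ?_
    exact Finset.one_le_prod fun i _ => Real.one_le_cosh _
  · rw [angle_of_notMem hlam hv]
    exact Real.arsinh_nonneg_iff.2 (Real.sqrt_nonneg _)

/-- One step of the tree recursion contracts weighted errors. -/
theorem abs_arsinh_div_prod_cosh_sub_le {ι : Type*} [Fintype ι] (hlam : 0 < lam) {w t t' : ι → ℝ}
    {W C : ℝ} (hW0 : 0 ≤ W) (hC : 0 ≤ C)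
    (hW : ∀ s : ι → ℝ, (∀ i, 0 ≤ s i ∧ s i < 1) →
      lam * (∏ i, (1 - s i ^ 2)) * ((∑ i, s i * w i) ^ 2 - W ^ 2) ≤ W ^ 2)
    (ht : ∀ i, 0 ≤ t i) (ht' : ∀ i, 0 ≤ t' i) (h : ∀ i, |t i - t' i| ≤ C * w i) :
    |Real.arsinh (√lam / ∏ i, Real.cosh (t i)) - Real.arsinh (√lam / ∏ i, Real.cosh (t' i))|
      ≤ C * W := by
  set τ : ℝ → ι → ℝ := fun θ i => t' i + θ * (t i - t' i) with hτ
  set q : ℝ → ℝ := fun θ => √lam / ∏ i, Real.cosh (τ θ i) with hq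
  have hP : ∀ θ, 0 < ∏ i, Real.cosh (τ θ i) := fun θ =>
    Finset.prod_pos fun i _ => Real.cosh_pos _
  have hqpos : ∀ θ, 0 < q θ := fun θ => div_pos (Real.sqrt_pos.2 hlam) (hP θ)
  have hτd : ∀ θ i, HasDerivAt (fun θ => τ θ i) (t i - t' i) θ := by
    intro θ i
    simpa [hτ] using ((hasDerivAt_id θ).mul_const (t i - t' i)).const_add (t' i)
  have hqd : ∀ θ, HasDerivAt q (q θ * -∑ i, Real.tanh (τ θ i) * (t i - t' i)) θ := by
    intro θ
    have h1 : HasDerivAt (fun θ => Real.exp (Real.log √lam - ∑ i, Real.log (Real.cosh (τ θ i))))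
        (Real.exp (Real.log √lam - ∑ i, Real.log (Real.cosh (τ θ i))) *
          -∑ i, Real.tanh (τ θ i) * (t i - t' i)) θ := by
      refine HasDerivAt.exp ?_
      refine HasDerivAt.const_sub _ ?_
      refine HasDerivAt.fun_sum fun i _ => ?_
      have := ((hτd θ i).cosh).log (Real.cosh_pos _).ne'
      rwa [mul_div_right_comm, ← Real.tanh_eq_sinh_div_cosh] at this
    have h2 : q = fun θ => Real.exp (Real.log √lam - ∑ i, Real.log (Real.cosh (τ θ i))) := by
      funext θ
      rw [Real.exp_sub, Real.exp_log (Real.sqrt_pos.2 hlam), Real.exp_sum]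
      simp only [hq, Real.exp_log (Real.cosh_pos _)]
    rw [h2]
    exact h1
  have hg : ∀ θ, HasDerivAt (fun θ => Real.arsinh (q θ))
      ((√(1 + q θ ^ 2))⁻¹ * (q θ * -∑ i, Real.tanh (τ θ i) * (t i - t' i))) θ := fun θ =>
    (hqd θ).arsinh
  have hbound : ∀ θ ∈ Set.Icc (0 : ℝ) 1,
      ‖(√(1 + q θ ^ 2))⁻¹ * (q θ * -∑ i, Real.tanh (τ θ i) * (t i - t' i))‖ ≤ C * W := by
    intro θ hθ
    have hτ0 : ∀ i, 0 ≤ τ θ i := by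
      intro i
      have : τ θ i = (1 - θ) * t' i + θ * t i := by simp only [hτ]; ring
      rw [this]
      exact add_nonneg (mul_nonneg (sub_nonneg.2 hθ.2) (ht' i)) (mul_nonneg hθ.1 (ht i))
    set s : ι → ℝ := fun i => Real.tanh (τ θ i) with hs
    have hs0 : ∀ i, 0 ≤ s i ∧ s i < 1 := fun i =>
      ⟨by rw [hs]; simp only; rw [Real.tanh_eq_sinh_div_cosh]
          exact div_nonneg (Real.sinh_nonneg_iff.2 (hτ0 i)) (Real.cosh_pos _).le,
        Real.tanh_lt_one _⟩
    have hS : |∑ i, s i * (t i - t' i)| ≤ C * ∑ i, s i * w i := by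
      refine (Finset.abs_sum_le_sum_abs _ _).trans ?_
      rw [Finset.mul_sum]
      refine Finset.sum_le_sum fun i _ => ?_
      rw [abs_mul, abs_of_nonneg (hs0 i).1, mul_left_comm]
      exact mul_le_mul_of_nonneg_left (h i) (hs0 i).1
    have hqs : q θ ^ 2 = lam * ∏ i, (1 - s i ^ 2) := by
      have hc : ∀ i, 1 - s i ^ 2 = (Real.cosh (τ θ i) ^ 2)⁻¹ := by
        intro i
        have := Real.cosh_sq (τ θ i)
        have hne := (Real.cosh_pos (τ θ i)).ne'
        simp only [hs, Real.tanh_eq_sinh_div_cosh]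
        field_simp
        linarith
      simp only [hc, Finset.prod_inv_distrib, Finset.prod_pow, hq]
      rw [div_pow, Real.sq_sqrt hlam.le, div_eq_mul_inv]
    have hkey := hW s hs0
    rw [← hqs] at hkey
    have hq1 : 0 < 1 + q θ ^ 2 := by positivity
    have hle : q θ * |∑ i, s i * w i| ≤ W * √(1 + q θ ^ 2) := by
      refine abs_le_of_sq_le_sq' ?_ (mul_nonneg hW0 (Real.sqrt_nonneg _)) |>.2
      rw [mul_pow, mul_pow, sq_abs, Real.sq_sqrt hq1.le]
      nlinarith
    rw [norm_mul, norm_mul, norm_neg, Real.norm_eq_abs, Real.norm_eq_abs, Real.norm_eq_abs,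
      abs_inv, abs_of_nonneg (Real.sqrt_nonneg _), abs_of_pos (hqpos θ),
      inv_mul_le_iff₀ (Real.sqrt_pos.2 hq1)]
    calc q θ * |∑ i, s i * (t i - t' i)| ≤ q θ * (C * ∑ i, s i * w i) :=
          mul_le_mul_of_nonneg_left hS (hqpos θ).le
      _ ≤ C * (q θ * |∑ i, s i * w i|) := by
          rw [mul_left_comm]
          exact mul_le_mul_of_nonneg_left
            (mul_le_mul_of_nonneg_left (le_abs_self _) (hqpos θ).le) hC
      _ ≤ C * (W * √(1 + q θ ^ 2)) := mul_le_mul_of_nonneg_left hle hC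
      _ = √(1 + q θ ^ 2) * (C * W) := by ring
  have := norm_image_sub_le_of_norm_deriv_le_segment_01' (f := fun θ => Real.arsinh (q θ))
    (fun θ _ => (hg θ).hasDerivWithinAt) fun θ hθ => hbound θ ⟨hθ.1, hθ.2.le⟩
  simpa [hq, hτ] using this

/-- A criterion for the hypothesis of `abs_arsinh_div_prod_cosh_sub_le`: the logarithm of the
left-hand side is concave, and `a` is close to its maximum. -/
theorem mul_prod_mul_le_of_certificate {ι : Type*} [Fintype ι] (hlam : 0 ≤ lam) {a w : ι → ℝ}
    {W t δ : ℝ} (ha : ∀ i, 0 ≤ a i ∧ a i < 1) (hw : ∀ i, 0 ≤ w i) (hW : 0 < W)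
    (ht : t = ∑ i, a i * w i) (htW : W < t)
    (hδ : δ = ∑ i, (2 * t * w i / (t ^ 2 - W ^ 2) - 2 * a i / (1 - a i ^ 2)) ^ 2 *
      (1 - a i ^ 2) / 4)
    (h : lam * (∏ i, (1 - a i ^ 2)) * (t ^ 2 - W ^ 2) ≤ W ^ 2 * (1 - δ))
    (s : ι → ℝ) (hs : ∀ i, 0 ≤ s i ∧ s i < 1) :
    lam * (∏ i, (1 - s i ^ 2)) * ((∑ i, s i * w i) ^ 2 - W ^ 2) ≤ W ^ 2 := by
  set S := ∑ i, s i * w i with hS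
  have hone : ∀ x : ℝ, 0 ≤ x → x < 1 → 0 < 1 - x ^ 2 := fun x h0 h1 => by nlinarith
  have hPs : 0 < ∏ i, (1 - s i ^ 2) := Finset.prod_pos fun i _ => hone _ (hs i).1 (hs i).2
  have hPa : 0 < ∏ i, (1 - a i ^ 2) := Finset.prod_pos fun i _ => hone _ (ha i).1 (ha i).2
  have hS0 : 0 ≤ S := Finset.sum_nonneg fun i _ => mul_nonneg (hs i).1 (hw i)
  rcases le_or_gt S W with hSW | hSW
  · have : S ^ 2 - W ^ 2 ≤ 0 := by nlinarith
    exact (mul_nonpos_of_nonneg_of_nonpos (mul_nonneg hlam hPs.le) this).trans (sq_nonneg W)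
  have htW2 : 0 < t ^ 2 - W ^ 2 := by nlinarith
  set c : ι → ℝ := fun i => 2 * t * w i / (t ^ 2 - W ^ 2) - 2 * a i / (1 - a i ^ 2) with hc
  have h1 : ∏ i, (1 - s i ^ 2) ≤ (∏ i, (1 - a i ^ 2)) *
      Real.exp (∑ i, (a i ^ 2 - s i ^ 2) / (1 - a i ^ 2)) := by
    rw [Real.exp_sum, ← Finset.prod_mul_distrib]
    refine Finset.prod_le_prod (fun i _ => (hone _ (hs i).1 (hs i).2).le) fun i _ => ?_
    have hai := hone _ (ha i).1 (ha i).2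
    have := Real.add_one_le_exp ((a i ^ 2 - s i ^ 2) / (1 - a i ^ 2))
    calc 1 - s i ^ 2 = (1 - a i ^ 2) * ((a i ^ 2 - s i ^ 2) / (1 - a i ^ 2) + 1) := by
          field_simp; ring
      _ ≤ _ := mul_le_mul_of_nonneg_left this hai.le
  have h2 : S ^ 2 - W ^ 2 ≤ (t ^ 2 - W ^ 2) *
      Real.exp (2 * t * (S - t) / (t ^ 2 - W ^ 2)) := by
    have hp : 0 < t - W := sub_pos.2 htW
    have hp' : 0 < t + W := by linarith
    have e1 := Real.add_one_le_exp ((S - t) / (t - W))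
    have e2 := Real.add_one_le_exp ((S - t) / (t + W))
    have f1 : S - W ≤ (t - W) * Real.exp ((S - t) / (t - W)) := by
      calc S - W = (t - W) * ((S - t) / (t - W) + 1) := by field_simp; ring
        _ ≤ _ := mul_le_mul_of_nonneg_left e1 hp.le
    have f2 : S + W ≤ (t + W) * Real.exp ((S - t) / (t + W)) := by
      calc S + W = (t + W) * ((S - t) / (t + W) + 1) := by field_simp; ring
        _ ≤ _ := mul_le_mul_of_nonneg_left e2 hp'.le
    have f3 : 2 * t * (S - t) / (t ^ 2 - W ^ 2) = (S - t) / (t - W) + (S - t) / (t + W) := by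
      have : t ^ 2 - W ^ 2 = (t - W) * (t + W) := by ring
      rw [this]; field_simp; ring
    rw [f3, Real.exp_add]
    calc S ^ 2 - W ^ 2 = (S - W) * (S + W) := by ring
      _ ≤ ((t - W) * Real.exp ((S - t) / (t - W))) * ((t + W) * Real.exp ((S - t) / (t + W))) :=
          mul_le_mul f1 f2 (by linarith) (by positivity)
      _ = _ := by ring
  have h3 : ∑ i, (a i ^ 2 - s i ^ 2) / (1 - a i ^ 2) + 2 * t * (S - t) / (t ^ 2 - W ^ 2) ≤ δ := by
    have : 2 * t * (S - t) / (t ^ 2 - W ^ 2) =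
        ∑ i, 2 * t * w i / (t ^ 2 - W ^ 2) * (s i - a i) := by
      have hSt : S - t = ∑ i, w i * (s i - a i) := by
        rw [hS, ht, ← Finset.sum_sub_distrib]
        exact Finset.sum_congr rfl fun i _ => by ring
      rw [hSt, Finset.mul_sum, Finset.sum_div]
      exact Finset.sum_congr rfl fun i _ => by ring
    rw [this, hδ, ← Finset.sum_add_distrib]
    refine Finset.sum_le_sum fun i _ => ?_
    have hai := hone _ (ha i).1 (ha i).2
    have hsq := sq_nonneg ((s i - a i) - c i * (1 - a i ^ 2) / 2)
    have e : (a i ^ 2 - s i ^ 2) / (1 - a i ^ 2) + 2 * t * w i / (t ^ 2 - W ^ 2) * (s i - a i) =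
        c i * (s i - a i) - (s i - a i) ^ 2 / (1 - a i ^ 2) := by
      simp only [hc]; field_simp; ring
    have e' : c i ^ 2 * (1 - a i ^ 2) / 4 - (c i * (s i - a i) - (s i - a i) ^ 2 / (1 - a i ^ 2)) =
        ((s i - a i) - c i * (1 - a i ^ 2) / 2) ^ 2 / (1 - a i ^ 2) := by
      field_simp; ring
    have := div_nonneg hsq hai.le
    rw [e]
    linarith
  have h4 : lam * (∏ i, (1 - s i ^ 2)) * (S ^ 2 - W ^ 2) ≤
      lam * (∏ i, (1 - a i ^ 2)) * (t ^ 2 - W ^ 2) * Real.exp δ := by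
    calc lam * (∏ i, (1 - s i ^ 2)) * (S ^ 2 - W ^ 2)
        ≤ lam * ((∏ i, (1 - a i ^ 2)) * Real.exp (∑ i, (a i ^ 2 - s i ^ 2) / (1 - a i ^ 2))) *
          ((t ^ 2 - W ^ 2) * Real.exp (2 * t * (S - t) / (t ^ 2 - W ^ 2))) := by
          refine mul_le_mul (mul_le_mul_of_nonneg_left h1 hlam) h2 (by nlinarith) ?_
          positivity
      _ = lam * (∏ i, (1 - a i ^ 2)) * (t ^ 2 - W ^ 2) *
          Real.exp (∑ i, (a i ^ 2 - s i ^ 2) / (1 - a i ^ 2) +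
            2 * t * (S - t) / (t ^ 2 - W ^ 2)) := by rw [Real.exp_add]; ring
      _ ≤ _ := mul_le_mul_of_nonneg_left (Real.exp_le_exp.2 h3) (by positivity)
  refine h4.trans ?_
  have h5 : (1 - δ) * Real.exp δ ≤ 1 := by
    have := Real.add_one_le_exp (-δ)
    calc (1 - δ) * Real.exp δ ≤ Real.exp (-δ) * Real.exp δ :=
          mul_le_mul_of_nonneg_right (by linarith) (Real.exp_pos _).le
      _ = 1 := by rw [← Real.exp_add]; simp
  calc lam * (∏ i, (1 - a i ^ 2)) * (t ^ 2 - W ^ 2) * Real.exp δ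
      ≤ W ^ 2 * (1 - δ) * Real.exp δ := mul_le_mul_of_nonneg_right h (Real.exp_pos _).le
    _ = W ^ 2 * ((1 - δ) * Real.exp δ) := by ring
    _ ≤ W ^ 2 * 1 := mul_le_mul_of_nonneg_left h5 (sq_nonneg W)
    _ = W ^ 2 := mul_one _

end HardCore

namespace HardCore

/-! ### Coordinate frames of the square lattice -/

/-- `a` and `b` are orthogonal unit vectors of `ℤ²`. -/
def IsAxes (a b : ℤ × ℤ) : Prop :=
  a.1 * a.1 + a.2 * a.2 = 1 ∧ b.1 * b.1 + b.2 * b.2 = 1 ∧ a.1 * b.1 + a.2 * b.2 = 0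

instance (a b : ℤ × ℤ) : Decidable (IsAxes a b) := by
  unfold IsAxes
  infer_instance

/-- The vector with coordinates `c` with respect to `a` and `b`. -/
def combine (a b c : ℤ × ℤ) : ℤ × ℤ := (c.1 * a.1 + c.2 * b.1, c.1 * a.2 + c.2 * b.2)

theorem combine_add (a b c d : ℤ × ℤ) : combine a b (c + d) = combine a b c + combine a b d := by
  ext <;> simp [combine] <;> ring

theorem combine_combine (a b a' b' c : ℤ × ℤ) :
    combine a b (combine a' b' c) = combine (combine a b a') (combine a b b') c := by
  ext <;> simp only [combine] <;> ring

theorem IsAxes.normSq_combine {a b : ℤ × ℤ} (h : IsAxes a b) (c : ℤ × ℤ) :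
    (combine a b c).1 * (combine a b c).1 + (combine a b c).2 * (combine a b c).2 =
      c.1 * c.1 + c.2 * c.2 := by
  obtain ⟨h1, h2, h3⟩ := h
  simp only [combine]
  linear_combination c.1 ^ 2 * h1 + c.2 ^ 2 * h2 + 2 * c.1 * c.2 * h3

theorem IsAxes.combine {a b a' b' : ℤ × ℤ} (h : IsAxes a b) (h' : IsAxes a' b') :
    IsAxes (combine a b a') (combine a b b') := by
  refine ⟨by rw [h.normSq_combine, h'.1], by rw [h.normSq_combine, h'.2.1], ?_⟩
  obtain ⟨h1, h2, h3⟩ := h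
  have := h'.2.2
  simp only [HardCore.combine]
  linear_combination a'.1 * b'.1 * h1 + a'.2 * b'.2 * h2 + (a'.1 * b'.2 + a'.2 * b'.1) * h3 + this

theorem normSq_eq_one_iff {x y : ℤ} : x * x + y * y = 1 ↔ |x| + |y| = 1 := by
  constructor
  · intro h
    have hx : |x| ≤ 1 := abs_le.2 ⟨by nlinarith [mul_self_nonneg y], by nlinarith [mul_self_nonneg y]⟩
    have hy : |y| ≤ 1 := abs_le.2 ⟨by nlinarith [mul_self_nonneg x], by nlinarith [mul_self_nonneg x]⟩
    rw [← abs_mul_abs_self x, ← abs_mul_abs_self y] at h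
    have hx0 := abs_nonneg x
    have hy0 := abs_nonneg y
    generalize |x| = X at *
    generalize |y| = Y at *
    interval_cases X <;> interval_cases Y <;> simp_all
  · intro h
    rw [← abs_mul_abs_self x, ← abs_mul_abs_self y]
    have hx0 := abs_nonneg x
    have hy0 := abs_nonneg y
    generalize |x| = X at *
    generalize |y| = Y at *
    have : X ≤ 1 := by omega
    have : Y ≤ 1 := by omega
    interval_cases X <;> interval_cases Y <;> simp_all

theorem normSq_eq_one_cases {x y : ℤ} (h : x * x + y * y = 1) :
    (x, y) ∈ [((1 : ℤ), (0 : ℤ)), (-1, 0), (0, 1), (0, -1)] := by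
  have h' := normSq_eq_one_iff.1 h
  have hx : -1 ≤ x ∧ x ≤ 1 := abs_le.1 (by have := abs_nonneg y; omega)
  have hy : -1 ≤ y ∧ y ≤ 1 := abs_le.1 (by have := abs_nonneg x; omega)
  obtain ⟨hx1, hx2⟩ := hx
  obtain ⟨hy1, hy2⟩ := hy
  interval_cases x <;> interval_cases y <;> simp_all

theorem squareLattice_adj_add_iff {v d : ℤ × ℤ} :
    squareLattice.Adj v (v + d) ↔ d.1 * d.1 + d.2 * d.2 = 1 := by
  rw [normSq_eq_one_iff]
  simp [squareLattice]

theorem IsAxes.exists_combine_eq {a b d : ℤ × ℤ} (h : IsAxes a b)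
    (hd : d.1 * d.1 + d.2 * d.2 = 1) :
    ∃ e : ℤ × ℤ, e.1 * e.1 + e.2 * e.2 = 1 ∧ HardCore.combine a b e = d := by
  have hcols : a.1 * a.1 + b.1 * b.1 = 1 ∧ a.2 * a.2 + b.2 * b.2 = 1 ∧
      a.1 * a.2 + b.1 * b.2 = 0 := by
    have ha := normSq_eq_one_cases h.1
    have hb := normSq_eq_one_cases h.2.1
    have hab := h.2.2
    obtain ⟨a1, a2⟩ := a
    obtain ⟨b1, b2⟩ := b
    simp only [List.mem_cons, Prod.mk.injEq, List.not_mem_nil, or_false] at ha hb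
    rcases ha with ⟨rfl, rfl⟩ | ⟨rfl, rfl⟩ | ⟨rfl, rfl⟩ | ⟨rfl, rfl⟩ <;>
      rcases hb with ⟨rfl, rfl⟩ | ⟨rfl, rfl⟩ | ⟨rfl, rfl⟩ | ⟨rfl, rfl⟩ <;> simp_all
  obtain ⟨c1, c2, c3⟩ := hcols
  refine ⟨(d.1 * a.1 + d.2 * a.2, d.1 * b.1 + d.2 * b.2), ?_, ?_⟩
  · simp only
    linear_combination d.1 ^ 2 * c1 + d.2 ^ 2 * c2 + 2 * d.1 * d.2 * c3 + hd
  · ext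
    · simp only [HardCore.combine]
      linear_combination d.1 * c1 + d.2 * c3
    · simp only [HardCore.combine]
      linear_combination d.2 * c2 + d.1 * c3

/-! ### Weighted patterns of removed vertices -/

/-- A neighbour of the current vertex, together with a frame at this neighbour (in the coordinates
of the current frame) in which it has the pattern number `target`. The number `tangent / 1000`
is an approximate maximiser used to certify the contraction. -/
structure Branch where
  dir : ℤ × ℤ
  ax : ℤ × ℤ
  ay : ℤ × ℤ
  target : ℕ
  tangent : ℕ

/-- A finite set of vertices known to be removed (relative to the current vertex), the weight given
to it, and the remaining neighbours in the order in which the tree recursion removes them. -/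
structure Pattern where
  removed : List (ℤ × ℤ)
  weight : ℕ
  branches : List Branch

/-- The pattern number `j` of a table. -/
def lookup (table : List Pattern) (j : ℕ) : Pattern := table.getD j ⟨[], 0, []⟩

/-- The patterns at the neighbours are really present: a neighbour sees what was known before, the
current vertex, and the neighbours that come earlier. -/
def embeds (table : List Pattern) : List (ℤ × ℤ) → List Branch → Bool
  | _, [] => true
  | S, b :: bs =>
    (decide (b.target < table.length) && decide (IsAxes b.ax b.ay) &&
      decide (b.dir.1 * b.dir.1 + b.dir.2 * b.dir.2 = 1) &&
      (lookup table b.target).removed.all fun c => S.elem (b.dir + combine b.ax b.ay c)) &&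
    embeds table (b.dir :: S) bs

/-- The certificate for one contraction step, for pairs of a tangent point and a weight. -/
def contracts (lam W : ℚ) (l : List (ℚ × ℚ)) : Bool :=
  let t := (l.map fun p => p.1 * p.2).sum
  let D := t ^ 2 - W ^ 2
  l.all (fun p => decide (0 ≤ p.1) && decide (p.1 < 1) && decide (0 ≤ p.2)) && decide (W < t) &&
    decide (lam * (l.map fun p => 1 - p.1 ^ 2).prod * D ≤ W ^ 2 * (1 - (l.map fun p =>
      (2 * t * p.2 / D - 2 * p.1 / (1 - p.1 ^ 2)) ^ 2 * (1 - p.1 ^ 2) / 4).sum))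

/-- The tangent points and weights of the branches. -/
def branchData (table : List Pattern) (bs : List Branch) : List (ℚ × ℚ) :=
  bs.map fun b => ((b.tangent : ℚ) / 1000, ((lookup table b.target).weight : ℚ))

theorem branchData_getElem_snd {table : List Pattern} {bs : List Branch} {j : ℕ}
    (hj : j < (branchData table bs).length) : (branchData table bs)[j].2 =
      (lookup table (bs[j]'(by rwa [branchData, List.length_map] at hj)).target).weight := by
  simp [branchData]

/-- All conditions on a pattern. -/
def Pattern.isValid (table : List Pattern) (lam κ : ℚ) (p : Pattern) : Bool :=
  decide (0 < p.weight) &&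
  ([(1, 0), (-1, 0), (0, 1), (0, -1)].all fun e =>
    p.removed.elem e || (p.branches.map Branch.dir).elem e) &&
  embeds table ((0, 0) :: p.removed) p.branches &&
  (p.branches.isEmpty || contracts lam (κ * p.weight) (branchData table p.branches))

theorem embeds_spec {table : List Pattern} {bs : List Branch} {S : List (ℤ × ℤ)}
    (h : embeds table S bs = true) (i : Fin bs.length) :
    bs[i].target < table.length ∧ IsAxes bs[i].ax bs[i].ay ∧
      bs[i].dir.1 * bs[i].dir.1 + bs[i].dir.2 * bs[i].dir.2 = 1 ∧
      ∀ c ∈ (lookup table bs[i].target).removed,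
        bs[i].dir + combine bs[i].ax bs[i].ay c ∈ S ∨
        bs[i].dir + combine bs[i].ax bs[i].ay c ∈ (bs.take i).map Branch.dir := by
  induction bs generalizing S with
  | nil => exact i.elim0
  | cons b bs ih =>
    simp only [embeds, Bool.and_eq_true, decide_eq_true_eq, List.all_eq_true, List.elem_eq_mem]
      at h
    obtain ⟨⟨⟨⟨h1, h2⟩, h3⟩, h4⟩, h5⟩ := h
    induction i using Fin.cases with
    | zero => exact ⟨h1, h2, h3, fun c hc => Or.inl (h4 c hc)⟩
    | succ i =>
      obtain ⟨g1, g2, g3, g4⟩ := ih h5 i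
      refine ⟨g1, g2, g3, fun c hc => ?_⟩
      have := g4 c hc
      simp only [Fin.getElem_fin, Fin.val_succ, List.getElem_cons_succ, List.take_succ_cons,
        List.map_cons, List.mem_cons] at this ⊢
      tauto

theorem contracts_spec {lam W : ℚ} {l : List (ℚ × ℚ)} (hW : 0 < W) (hlam : 0 ≤ lam)
    (h : contracts lam W l = true) {r : ℝ} (hr : 0 ≤ r) (hrl : r ≤ lam)
    (s : Fin l.length → ℝ) (hs : ∀ i, 0 ≤ s i ∧ s i < 1) :
    r * (∏ i, (1 - s i ^ 2)) * ((∑ i, s i * ((l[i].2 : ℚ) : ℝ)) ^ 2 - (W : ℝ) ^ 2)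
      ≤ (W : ℝ) ^ 2 := by
  simp only [contracts, Bool.and_eq_true, decide_eq_true_eq, List.all_eq_true] at h
  obtain ⟨⟨h1, h2⟩, h3⟩ := h
  simp only [← Fin.sum_univ_fun_getElem, ← Fin.prod_univ_fun_getElem] at h2 h3
  have key := mul_prod_mul_le_of_certificate (ι := Fin l.length) (lam := (lam : ℝ))
    (a := fun i => ((l[i].1 : ℚ) : ℝ)) (w := fun i => ((l[i].2 : ℚ) : ℝ)) (W := (W : ℝ))
    (t := ((∑ i : Fin l.length, l[i].1 * l[i].2 : ℚ) : ℝ))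
    (by exact_mod_cast hlam)
    (fun i => by
      have := h1 l[i] (List.getElem_mem _)
      exact ⟨by exact_mod_cast this.1.1, by exact_mod_cast this.1.2⟩)
    (fun i => by
      have := h1 l[i] (List.getElem_mem _)
      exact_mod_cast this.2)
    (by exact_mod_cast hW) (by push_cast; rfl) (by exact_mod_cast h2) rfl
    (by exact_mod_cast h3) s hs
  rcases le_or_gt ((∑ i, s i * ((l[i].2 : ℚ) : ℝ)) ^ 2 - (W : ℝ) ^ 2) 0 with hneg | hpos
  · have hP : 0 ≤ ∏ i, (1 - s i ^ 2) := Finset.prod_nonneg fun i _ => by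
      have := hs i
      nlinarith
    exact (mul_nonpos_of_nonneg_of_nonpos (mul_nonneg hr hP) hneg).trans (sq_nonneg _)
  · have hP : 0 ≤ ∏ i, (1 - s i ^ 2) := Finset.prod_nonneg fun i _ => by
      have := hs i
      nlinarith
    refine le_trans ?_ key
    exact mul_le_mul_of_nonneg_right (mul_le_mul_of_nonneg_right hrl hP) hpos.le

/-- Decay of correlations from a table of valid patterns. -/
theorem abs_angle_sub_angle_le {table : List Pattern} {lam₀ κ : ℚ} (hκ : 0 < κ)
    (htable : ∀ p ∈ table, p.isValid table lam₀ κ = true) {lam : ℝ} (hlam : 0 < lam)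
    (hlam₀ : lam ≤ lam₀) (n : ℕ) :
    ∀ p ∈ table, ∀ v a b : ℤ × ℤ, IsAxes a b → ∀ A B : Finset (ℤ × ℤ),
      (∀ c ∈ p.removed, v + combine a b c ∉ A ∧ v + combine a b c ∉ B) →
      (∀ x : ℤ × ℤ, |x.1 - v.1| + |x.2 - v.2| ≤ n → (x ∈ A ↔ x ∈ B)) →
      |angle squareLattice lam A v - angle squareLattice lam B v| ≤
        Real.arsinh √lam * (κ : ℝ) ^ n * p.weight := by
  have hM : 0 ≤ Real.arsinh √lam := Real.arsinh_nonneg_iff.2 (Real.sqrt_nonneg _)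
  have hκ' : (0 : ℝ) < κ := by exact_mod_cast hκ
  induction n with
  | zero =>
    intro p hp v a b _ A B _ _
    have hw := htable p hp
    simp only [Pattern.isValid, Bool.and_eq_true, decide_eq_true_eq] at hw
    have hw : (1 : ℝ) ≤ p.weight := by exact_mod_cast hw.1.1.1
    have h1 := angle_nonneg (G := squareLattice) (lam := lam) (A := A) (v := v)
    have h2 := angle_nonneg (G := squareLattice) (lam := lam) (A := B) (v := v)
    have h3 := angle_le (G := squareLattice) (A := A) (v := v) hlam.le
    have h4 := angle_le (G := squareLattice) (A := B) (v := v) hlam.le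
    rw [pow_zero, mul_one]
    exact (abs_sub_le_iff.2 ⟨by linarith, by linarith⟩).trans (le_mul_of_one_le_right hM hw)
  | succ n ih =>
    intro p hp v a b hab A B hrem hAB
    have hval := htable p hp
    simp only [Pattern.isValid, Bool.and_eq_true, decide_eq_true_eq, Bool.or_eq_true,
      List.all_eq_true, List.elem_eq_mem, List.isEmpty_iff] at hval
    obtain ⟨⟨⟨hw, hcover⟩, hemb⟩, hcon⟩ := hval
    have hRHS : 0 ≤ Real.arsinh √lam * (κ : ℝ) ^ (n + 1) * p.weight := by positivity
    by_cases hv : v ∈ A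
    swap
    · have hvB : v ∉ B := fun h => hv ((hAB v (by simp; positivity)).2 h)
      rwa [angle_of_notMem hlam.le hv, angle_of_notMem hlam.le hvB, sub_self, abs_zero]
    have hvB : v ∈ B := (hAB v (by simp; positivity)).1 hv
    set us := p.branches.map fun β => v + combine a b β.dir with hus
    have hlen : us.length = p.branches.length := List.length_map ..
    have hadj : ∀ u ∈ us, squareLattice.Adj v u := by
      intro u hu
      obtain ⟨β, hβ, rfl⟩ := List.mem_map.1 hu
      obtain ⟨i, hi, rfl⟩ := List.getElem_of_mem hβ
      rw [squareLattice_adj_add_iff, hab.normSq_combine]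
      exact (embeds_spec hemb ⟨i, hi⟩).2.2.1
    have hcov : ∀ u, squareLattice.Adj v u → (u ∈ A ∨ u ∈ B) → u ∈ us := by
      intro u hu huAB
      obtain ⟨d, rfl⟩ : ∃ d, u = v + d := ⟨u - v, by simp⟩
      obtain ⟨e, he, rfl⟩ := hab.exists_combine_eq (squareLattice_adj_add_iff.1 hu)
      rcases hcover e (normSq_eq_one_cases he) with h | h
      · have := hrem e h
        tauto
      · obtain ⟨β, hβ, rfl⟩ := List.mem_map.1 h
        exact List.mem_map_of_mem hβ
    have hA := sinh_angle hlam.le hv us hadj fun u hu huv => hcov u huv (Or.inl hu)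
    have hB := sinh_angle hlam.le hvB us hadj fun u hu huv => hcov u huv (Or.inr hu)
    rw [← Real.arsinh_sinh (angle squareLattice lam A v),
      ← Real.arsinh_sinh (angle squareLattice lam B v), hA, hB]
    rcases hcon with hcon | hcon
    · have : us = [] := by rw [hus, hcon]; rfl
      rw [this]
      simpa using hRHS
    have hdata : (branchData table p.branches).length = us.length := by
      rw [hlen, branchData, List.length_map]
    set w : Fin us.length → ℝ := fun i =>
      (lookup table (p.branches[i.1]'(hlen ▸ i.2)).target).weight with hwdef
    have hstep := abs_arsinh_div_prod_cosh_sub_le (ι := Fin us.length) (w := w)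
      (W := (κ : ℝ) * p.weight) (C := Real.arsinh √lam * (κ : ℝ) ^ n)
      (t := fun i => angle squareLattice lam (A.erase v \ (us.take i).toFinset) us[i])
      (t' := fun i => angle squareLattice lam (B.erase v \ (us.take i).toFinset) us[i])
      hlam (by positivity) (by positivity) ?_ (fun i => angle_nonneg) (fun i => angle_nonneg) ?_
    · refine hstep.trans_eq ?_
      ring
    · intro s hs
      have hWpos : 0 < κ * (p.weight : ℚ) := mul_pos hκ (by exact_mod_cast hw)
      have := contracts_spec hWpos (by exact_mod_cast hlam.le.trans hlam₀) hcon hlam.le hlam₀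
        (fun i => s (Fin.cast hdata i)) fun i => hs _
      have hprod : ∏ i, (1 - s (Fin.cast hdata i) ^ 2) = ∏ i, (1 - s i ^ 2) :=
        Fintype.prod_equiv (finCongr hdata) _ _ fun i => rfl
      have hsum : ∑ i, s (Fin.cast hdata i) * (((branchData table p.branches)[i].2 : ℚ) : ℝ) =
          ∑ i, s i * w i :=
        Fintype.sum_equiv (finCongr hdata) _ _ fun i => by
          rw [Fin.getElem_fin, branchData_getElem_snd, Rat.cast_natCast]
          rfl
      rw [hprod, hsum] at this
      push_cast at this
      exact this
    · intro i
      set β := p.branches[i.1]'(hlen ▸ i.2) with hβ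
      obtain ⟨g1, g2, g3, g4⟩ := embeds_spec hemb ⟨i.1, hlen ▸ i.2⟩
      have hui : us[i] = v + combine a b β.dir := by simp [hus, hβ]
      have htake : us.take i = (p.branches.take i).map fun β => v + combine a b β.dir := by
        simp only [hus, List.map_take]
      have hlook : lookup table β.target ∈ table := by
        have g1 : β.target < table.length := g1
        rw [lookup, List.getD_eq_getElem _ _ g1]
        exact List.getElem_mem _
      rw [hui]
      refine ih (lookup table β.target) hlook (v + combine a b β.dir)
        (combine a b β.ax) (combine a b β.ay) (hab.combine g2) _ _ ?_ ?_
      · intro c hc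
        have hpos : v + combine a b β.dir + combine (combine a b β.ax) (combine a b β.ay) c =
            v + combine a b (β.dir + combine β.ax β.ay c) := by
          rw [← combine_combine, combine_add, add_assoc]
        rw [hpos]
        have hmem := g4 c hc
        have hgoal : ∀ X : Finset (ℤ × ℤ), (∀ c ∈ p.removed, v + combine a b c ∉ X) →
            v + combine a b (β.dir + combine β.ax β.ay c) ∉
              X.erase v \ (us.take i).toFinset := by
          intro X hX hmemX
          rw [Finset.mem_sdiff, Finset.mem_erase, List.mem_toFinset] at hmemX
          rcases hmem with hmem | hmem
          · rcases List.mem_cons.1 hmem with hmem | hmem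
            · refine hmemX.1.1 ?_
              have : β.dir + combine β.ax β.ay c = (0, 0) := hmem
              rw [this]
              simp [combine]
            · exact hX _ hmem hmemX.1.2
          · refine hmemX.2 ?_
            rw [htake]
            obtain ⟨β', hβ', he⟩ := List.mem_map.1 hmem
            refine List.mem_map.2 ⟨β', hβ', ?_⟩
            rw [he]
            rfl
        exact ⟨hgoal A fun c hc => (hrem c hc).1, hgoal B fun c hc => (hrem c hc).2⟩
      · intro x hx
        have hd : |(combine a b β.dir).1| + |(combine a b β.dir).2| = 1 := by
          rw [← normSq_eq_one_iff, hab.normSq_combine]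
          exact g3
        have hxv : |x.1 - v.1| + |x.2 - v.2| ≤ (n + 1 : ℕ) := by
          have e1 := abs_add_le (x.1 - (v + combine a b β.dir).1) (combine a b β.dir).1
          have e2 := abs_add_le (x.2 - (v + combine a b β.dir).2) (combine a b β.dir).2
          simp only [Prod.fst_add, Prod.snd_add] at e1 e2 hx
          rw [show x.1 - (v.1 + (combine a b β.dir).1) + (combine a b β.dir).1 = x.1 - v.1 by ring]
            at e1
          rw [show x.2 - (v.2 + (combine a b β.dir).2) + (combine a b β.dir).2 = x.2 - v.2 by ring]
            at e2
          push_cast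
          linarith
        simp only [Finset.mem_sdiff, Finset.mem_erase, hAB x hxv]

end HardCore

namespace HardCore

/-- Patterns (up to symmetry) for the walks behind the tree recursion on `ℤ²`; the first one is the
starting pattern, in which nothing is known to be removed. -/
def patternTable : List Pattern :=
  [⟨[], 1226375,
    [⟨(-1, 0), (-1, 0), (0, 1), 1, 566⟩, ⟨(0, -1), (0, -1), (1, 0), 1, 566⟩,
     ⟨(0, 1), (0, 1), (1, 0), 1, 566⟩, ⟨(1, 0), (1, 0), (0, 1), 2, 427⟩]⟩,
   ⟨[(-1, 0)], 1000000,
    [⟨(0, -1), (0, -1), (1, 0), 1, 633⟩, ⟨(0, 1), (0, 1), (1, 0), 1, 633⟩,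
     ⟨(1, 0), (1, 0), (0, 1), 2, 498⟩]⟩,
   ⟨[(-2, 0), (-1, -1), (-1, 1)], 627445,
    [⟨(-1, 0), (1, 0), (0, 1), 3, 2⟩, ⟨(1, 0), (1, 0), (0, 1), 1, 762⟩,
     ⟨(0, -1), (0, -1), (1, 0), 5, 393⟩, ⟨(0, 1), (0, 1), (1, 0), 4, 387⟩]⟩,
   ⟨[(-1, 0), (0, -1), (0, 1), (1, 0)], 1000,
    []⟩,
   ⟨[(-2, -1), (-2, 0), (-1, -2), (-1, -1), (-1, 1), (0, -1)], 249652,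
    [⟨(-1, 0), (1, 0), (0, 1), 3, 4⟩, ⟨(1, 0), (1, 0), (0, 1), 6, 707⟩,
     ⟨(0, 1), (0, 1), (1, 0), 4, 647⟩]⟩,
   ⟨[(-2, -1), (-1, -1), (-1, 0), (-1, 1), (0, -1)], 255516,
    [⟨(1, 0), (1, 0), (0, 1), 7, 707⟩, ⟨(0, 1), (0, 1), (1, 0), 5, 647⟩]⟩,
   ⟨[(-3, -1), (-3, 0), (-2, -2), (-2, -1), (-2, 0), (-2, 1), (-1, -1), (-1, 0)], 316910,
    [⟨(1, 0), (1, 0), (0, 1), 9, 648⟩, ⟨(0, 1), (1, 0), (0, 1), 10, 586⟩,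
     ⟨(0, -1), (1, 0), (0, -1), 8, 544⟩]⟩,
   ⟨[(-3, -1), (-2, -1), (-2, 0), (-2, 1), (-1, -1), (-1, 0)], 324357,
    [⟨(1, 0), (1, 0), (0, 1), 12, 643⟩, ⟨(0, 1), (1, 0), (0, 1), 13, 583⟩,
     ⟨(0, -1), (1, 0), (0, -1), 11, 555⟩]⟩,
   ⟨[(-3, 0), (-2, -2), (-2, -1), (-2, 0), (-2, 1), (-1, -1), (-1, 0), (0, -2), (1, -1)], 232307,
    [⟨(0, -1), (1, 0), (0, 1), 3, 5⟩, ⟨(0, 1), (0, 1), (1, 0), 14, 694⟩,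
     ⟨(1, 0), (1, 0), (0, 1), 15, 664⟩]⟩,
   ⟨[(-3, -2), (-3, -1), (-3, 0), (-3, 1), (-2, 0), (-1, 0)], 335498,
    [⟨(1, 0), (1, 0), (0, 1), 17, 639⟩, ⟨(0, -1), (1, 0), (0, -1), 18, 565⟩,
     ⟨(0, 1), (1, 0), (0, 1), 16, 579⟩]⟩,
   ⟨[(-3, -1), (-2, -2), (-2, -1), (-2, 0), (-1, -1), (0, -1), (1, -1)], 268818,
    [⟨(0, 1), (0, 1), (1, 0), 20, 674⟩, ⟨(-1, 0), (0, 1), (1, 0), 21, 433⟩,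
     ⟨(1, 0), (1, 0), (0, 1), 19, 618⟩]⟩,
   ⟨[(-2, -2), (-2, -1), (-2, 0), (-1, -1), (-1, 0), (0, -2), (1, -1)], 247579,
    [⟨(0, -1), (1, 0), (0, 1), 3, 4⟩, ⟨(0, 1), (0, 1), (1, 0), 22, 706⟩,
     ⟨(1, 0), (1, 0), (0, 1), 4, 649⟩]⟩,
   ⟨[(-4, -1), (-3, -1), (-3, 0), (-3, 1), (-2, -1), (-2, 0), (-1, 0)], 337631,
    [⟨(1, 0), (1, 0), (0, 1), 24, 640⟩, ⟨(0, 1), (1, 0), (0, 1), 25, 579⟩,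
     ⟨(0, -1), (1, 0), (0, -1), 23, 564⟩]⟩,
   ⟨[(-2, -2), (-2, -1), (-2, 0), (-1, -1), (0, -1), (1, -1)], 272255,
    [⟨(0, 1), (0, 1), (1, 0), 22, 672⟩, ⟨(1, 0), (1, 0), (0, 1), 5, 619⟩,
     ⟨(-1, 0), (-1, 0), (0, 1), 26, 436⟩]⟩,
   ⟨[(-3, -2), (-3, 0), (-2, -2), (-2, -1), (-2, 0), (-2, 1), (-1, -3), (-1, -2), (-1, -1), (-1, 0), (0, -2)], 279587,
    [⟨(1, 0), (1, 0), (0, 1), 27, 669⟩, ⟨(0, 1), (1, 0), (0, 1), 10, 626⟩,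
     ⟨(0, -1), (0, -1), (1, 0), 26, 428⟩]⟩,
   ⟨[(-4, 0), (-3, -2), (-3, -1), (-3, 0), (-3, 1), (-2, -1), (-2, 0), (-1, -2), (-1, -1), (-1, 1), (0, -1)], 248651,
    [⟨(-1, 0), (1, 0), (0, 1), 3, 4⟩, ⟨(1, 0), (1, 0), (0, 1), 6, 708⟩,
     ⟨(0, 1), (1, 0), (0, 1), 28, 646⟩]⟩,
   ⟨[(-3, -2), (-3, -1), (-3, 0), (-2, -1), (-1, -1), (0, -2), (1, -1)], 278424,
    [⟨(0, -1), (1, 0), (0, 1), 3, 4⟩, ⟨(0, 1), (1, 0), (0, 1), 29, 664⟩,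
     ⟨(-1, 0), (1, 0), (0, 1), 30, 486⟩, ⟨(1, 0), (1, 0), (0, 1), 4, 604⟩]⟩,
   ⟨[(-4, -2), (-4, -1), (-4, 0), (-4, 1), (-3, 0), (-2, 0), (-1, 0)], 344486,
    [⟨(1, 0), (1, 0), (0, 1), 32, 637⟩, ⟨(0, -1), (1, 0), (0, -1), 33, 568⟩,
     ⟨(0, 1), (1, 0), (0, 1), 31, 579⟩]⟩,
   ⟨[(-3, -2), (-3, -1), (-3, 0), (-3, 1), (-2, -1), (-1, -1), (0, -1), (1, -1)], 264811,
    [⟨(0, 1), (1, 0), (0, 1), 35, 668⟩, ⟨(-1, 0), (1, 0), (0, 1), 36, 441⟩,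
     ⟨(1, 0), (1, 0), (0, 1), 34, 622⟩]⟩,
   ⟨[(-3, -2), (-3, -1), (-3, 0), (-2, -1), (-2, 0), (-1, -1), (-1, 1), (0, -1)], 251462,
    [⟨(-1, 0), (1, 0), (0, 1), 3, 4⟩, ⟨(1, 0), (1, 0), (0, 1), 37, 708⟩,
     ⟨(0, 1), (0, 1), (1, 0), 4, 645⟩]⟩,
   ⟨[(-3, -2), (-2, -3), (-2, -2), (-2, -1), (-2, 0), (-2, 1), (-1, -2), (-1, 0)], 310146,
    [⟨(1, 0), (1, 0), (0, 1), 39, 649⟩, ⟨(0, -1), (1, 0), (0, 1), 40, 531⟩,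
     ⟨(0, 1), (0, 1), (1, 0), 38, 594⟩]⟩,
   ⟨[(-2, -1), (-1, -2), (-1, -1), (-1, 0), (-1, 1), (-1, 2), (0, -1), (0, 1), (1, 1)], 134037,
    [⟨(1, 0), (1, 0), (0, 1), 41, 807⟩]⟩,
   ⟨[(-3, -2), (-2, -2), (-2, -1), (-2, 0), (-2, 1), (-1, -2), (-1, 0)], 312376,
    [⟨(1, 0), (1, 0), (0, 1), 39, 647⟩, ⟨(0, -1), (1, 0), (0, 1), 42, 538⟩,
     ⟨(0, 1), (0, 1), (1, 0), 38, 592⟩]⟩,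
   ⟨[(-4, 0), (-3, -2), (-3, -1), (-3, 0), (-2, -1), (-2, 0), (-1, -1), (0, -2), (1, -1)], 265803,
    [⟨(0, -1), (1, 0), (0, 1), 3, 4⟩, ⟨(0, 1), (1, 0), (0, 1), 43, 674⟩,
     ⟨(-1, 0), (1, 0), (0, 1), 44, 429⟩, ⟨(1, 0), (1, 0), (0, 1), 4, 619⟩]⟩,
   ⟨[(-4, -1), (-4, 0), (-4, 1), (-3, 0), (-2, 0), (-1, 0)], 348046,
    [⟨(1, 0), (1, 0), (0, 1), 32, 634⟩, ⟨(0, -1), (1, 0), (0, -1), 31, 575⟩,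
     ⟨(0, 1), (1, 0), (0, 1), 31, 575⟩]⟩,
   ⟨[(-3, -2), (-3, -1), (-3, 0), (-2, -1), (-1, -1), (0, -1), (1, -1)], 279357,
    [⟨(0, 1), (1, 0), (0, 1), 29, 663⟩, ⟨(-1, 0), (1, 0), (0, 1), 30, 485⟩,
     ⟨(1, 0), (1, 0), (0, 1), 34, 606⟩]⟩,
   ⟨[(-2, 0), (-1, -1), (-1, 1), (0, -1), (1, 0)], 137243,
    [⟨(-1, 0), (1, 0), (0, 1), 3, 9⟩, ⟨(0, 1), (0, 1), (1, 0), 4, 807⟩]⟩,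
   ⟨[(-3, -2), (-3, -1), (-3, 0), (-3, 1), (-2, -3), (-2, -2), (-2, -1), (-2, 0), (-1, -2), (-1, 0)], 317215,
    [⟨(1, 0), (1, 0), (0, 1), 45, 651⟩, ⟨(0, -1), (1, 0), (0, 1), 40, 525⟩,
     ⟨(0, 1), (1, 0), (0, 1), 16, 597⟩]⟩,
   ⟨[(-3, -2), (-3, -1), (-3, 0), (-2, -1), (-1, -3), (-1, -1), (-1, 0), (0, -2), (1, -1)], 247260,
    [⟨(0, -1), (1, 0), (0, 1), 3, 5⟩, ⟨(0, 1), (1, 0), (0, 1), 29, 705⟩,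
     ⟨(1, 0), (1, 0), (0, 1), 4, 650⟩]⟩,
   ⟨[(-3, -3), (-3, -2), (-3, -1), (-2, -2), (-1, -2), (0, -2), (0, -1), (1, -2)], 311676,
    [⟨(0, 1), (0, 1), (1, 0), 46, 648⟩, ⟨(1, 0), (1, 0), (0, 1), 47, 593⟩,
     ⟨(-1, 0), (0, 1), (1, 0), 48, 534⟩]⟩,
   ⟨[(-2, -2), (-2, -1), (-2, 0), (-1, -1), (0, -1), (1, -1), (1, 0), (1, 1), (2, -1)], 167033,
    [⟨(0, 1), (0, 1), (1, 0), 49, 736⟩, ⟨(-1, 0), (-1, 0), (0, 1), 26, 597⟩]⟩,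
   ⟨[(-4, -2), (-4, -1), (-4, 0), (-3, -1), (-2, -1), (-1, -1), (0, -1), (1, -1)], 285058,
    [⟨(0, 1), (1, 0), (0, 1), 50, 662⟩, ⟨(-1, 0), (1, 0), (0, 1), 51, 499⟩,
     ⟨(1, 0), (1, 0), (0, 1), 34, 600⟩]⟩,
   ⟨[(-5, -1), (-5, 0), (-5, 1), (-4, 0), (-3, 0), (-2, 0), (-1, 0)], 351532,
    [⟨(1, 0), (1, 0), (0, 1), 53, 633⟩, ⟨(0, -1), (1, 0), (0, -1), 52, 576⟩,
     ⟨(0, 1), (1, 0), (0, 1), 52, 576⟩]⟩,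
   ⟨[(-4, -2), (-4, -1), (-4, 0), (-4, 1), (-3, -1), (-2, -1), (-1, -1), (0, -1), (1, -1)], 275205,
    [⟨(0, 1), (1, 0), (0, 1), 54, 663⟩, ⟨(-1, 0), (1, 0), (0, 1), 55, 478⟩,
     ⟨(1, 0), (1, 0), (0, 1), 34, 610⟩]⟩,
   ⟨[(-3, -1), (-2, -1), (-2, 0), (-1, -1), (-1, 1), (0, -1)], 252085,
    [⟨(-1, 0), (1, 0), (0, 1), 3, 4⟩, ⟨(1, 0), (1, 0), (0, 1), 56, 709⟩,
     ⟨(0, 1), (0, 1), (1, 0), 4, 645⟩]⟩,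
   ⟨[(-3, -2), (-3, -1), (-3, 0), (-2, -2), (-1, -2), (0, -2), (0, -1), (1, -2)], 299110,
    [⟨(0, 1), (0, 1), (1, 0), 57, 654⟩, ⟨(1, 0), (1, 0), (0, 1), 47, 606⟩,
     ⟨(-1, 0), (0, 1), (1, 0), 58, 505⟩]⟩,
   ⟨[(-2, -2), (-2, -1), (-2, 0), (-2, 1), (-1, -1), (0, -1), (1, -1), (1, 0), (1, 1), (2, -1)], 135680,
    [⟨(0, 1), (0, 1), (1, 0), 59, 751⟩, ⟨(-1, 0), (-1, 0), (0, 1), 60, 556⟩]⟩,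
   ⟨[(-4, -2), (-4, -1), (-4, 0), (-3, -1), (-3, 0), (-2, -1), (-2, 0), (-2, 1), (-1, -1), (-1, 0)], 320861,
    [⟨(1, 0), (1, 0), (0, 1), 12, 646⟩, ⟨(0, 1), (1, 0), (0, 1), 10, 583⟩,
     ⟨(0, -1), (1, 0), (0, -1), 61, 551⟩]⟩,
   ⟨[(-3, -2), (-2, -2), (-2, 0), (-1, -2), (-1, -1), (-1, 1), (0, -2)], 270055,
    [⟨(-1, 0), (1, 0), (0, 1), 3, 4⟩, ⟨(1, 0), (1, 0), (0, 1), 22, 674⟩,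
     ⟨(0, -1), (1, 0), (0, 1), 62, 439⟩, ⟨(0, 1), (0, 1), (1, 0), 4, 615⟩]⟩,
   ⟨[(-4, -2), (-3, -2), (-3, -1), (-3, 0), (-3, 1), (-2, -2), (-2, 0), (-1, 0)], 330029,
    [⟨(1, 0), (1, 0), (0, 1), 17, 644⟩, ⟨(0, 1), (1, 0), (0, 1), 25, 585⟩,
     ⟨(0, -1), (1, 0), (0, 1), 63, 551⟩]⟩,
   ⟨[(-3, -1), (-2, -2), (-2, -1), (-2, 0), (-2, 1), (-1, -1), (-1, 1), (0, 1), (1, 1)], 217651,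
    [⟨(-1, 0), (1, 0), (0, 1), 3, 5⟩, ⟨(1, 0), (1, 0), (0, 1), 64, 694⟩,
     ⟨(0, -1), (1, 0), (0, -1), 8, 664⟩]⟩,
   ⟨[(-3, -1), (-2, -2), (-2, -1), (-2, 0), (-2, 1), (-2, 2), (-1, -1), (-1, 1), (0, 1)], 243826,
    [⟨(-1, 0), (1, 0), (0, 1), 3, 5⟩, ⟨(1, 0), (1, 0), (0, -1), 65, 715⟩,
     ⟨(0, -1), (1, 0), (0, -1), 8, 635⟩]⟩,
   ⟨[(-3, -1), (-2, -1), (-2, 0), (-2, 1), (-1, -1), (-1, 1), (0, 1), (1, 1)], 224249,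
    [⟨(-1, 0), (1, 0), (0, 1), 3, 5⟩, ⟨(1, 0), (1, 0), (0, 1), 64, 687⟩,
     ⟨(0, -1), (1, 0), (0, -1), 11, 672⟩]⟩,
   ⟨[(-4, -1), (-3, -2), (-3, -1), (-2, -2), (-2, -1), (-1, -2), (0, -3), (0, -2), (0, -1), (1, -2)], 306912,
    [⟨(0, 1), (0, 1), (1, 0), 46, 653⟩, ⟨(-1, 0), (1, 0), (0, 1), 66, 522⟩,
     ⟨(1, 0), (0, 1), (1, 0), 10, 596⟩]⟩,
   ⟨[(-2, -2), (-2, -1), (-2, 0), (-1, -1), (-1, 0), (0, -1), (1, -2), (1, -1), (1, 0), (1, 1), (2, -1)], 130695,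
    [⟨(0, 1), (0, 1), (1, 0), 49, 807⟩]⟩,
   ⟨[(-4, -1), (-4, 0), (-4, 1), (-3, -2), (-3, -1), (-3, 0), (-2, -2), (-2, 0), (-1, 0)], 339553,
    [⟨(1, 0), (1, 0), (0, 1), 32, 641⟩, ⟨(0, 1), (1, 0), (0, 1), 31, 583⟩,
     ⟨(0, -1), (1, 0), (0, -1), 67, 558⟩]⟩,
   ⟨[(-3, -3), (-3, -2), (-3, -1), (-3, 0), (-3, 1), (-2, -3), (-2, 0), (-1, 0)], 330705,
    [⟨(1, 0), (1, 0), (0, 1), 68, 642⟩, ⟨(0, -1), (1, 0), (0, 1), 69, 556⟩,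
     ⟨(0, 1), (1, 0), (0, 1), 16, 584⟩]⟩,
   ⟨[(-3, -2), (-2, -2), (-1, -2), (-1, -1), (-1, 0), (-1, 1), (0, -2)], 270762,
    [⟨(1, 0), (1, 0), (0, 1), 22, 673⟩, ⟨(0, -1), (1, 0), (0, 1), 62, 439⟩,
     ⟨(0, 1), (0, 1), (1, 0), 19, 616⟩]⟩,
   ⟨[(-3, -2), (-2, -1), (-2, 0), (-2, 1), (-1, -2), (-1, 1), (0, 2), (1, 1)], 220582,
    [⟨(-1, 0), (0, 1), (1, 0), 70, 330⟩, ⟨(0, 1), (1, 0), (0, 1), 3, 5⟩,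
     ⟨(0, -1), (0, -1), (1, 0), 8, 654⟩, ⟨(1, 0), (1, 0), (0, -1), 4, 672⟩]⟩,
   ⟨[(-3, -2), (-2, -2), (-2, -1), (-2, 0), (-2, 1), (-2, 2), (-1, -2), (-1, 0), (-1, 1), (0, 1)], 237747,
    [⟨(1, 0), (1, 0), (0, 1), 71, 717⟩, ⟨(0, -1), (1, 0), (0, 1), 42, 632⟩]⟩,
   ⟨[(-4, -2), (-3, -2), (-2, -2), (-1, -2), (0, -2), (0, -1), (1, -2)], 316675,
    [⟨(0, 1), (0, 1), (1, 0), 9, 648⟩, ⟨(1, 0), (1, 0), (0, 1), 47, 589⟩,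
     ⟨(-1, 0), (1, 0), (0, 1), 72, 540⟩]⟩,
   ⟨[(-3, -2), (-3, -1), (-3, 0), (-2, -1), (-1, -1), (0, -1), (1, -1), (1, 0), (1, 1), (2, -1)], 178583,
    [⟨(0, 1), (1, 0), (0, 1), 73, 718⟩, ⟨(-1, 0), (1, 0), (0, 1), 30, 630⟩]⟩,
   ⟨[(-5, -1), (-5, 0), (-4, -1), (-3, -1), (-2, -1), (-1, -1), (0, -1), (1, -1)], 288659,
    [⟨(0, 1), (1, 0), (0, 1), 50, 658⟩, ⟨(-1, 0), (1, 0), (0, 1), 74, 513⟩,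
     ⟨(1, 0), (1, 0), (0, 1), 34, 596⟩]⟩,
   ⟨[(-5, 0), (-4, 0), (-3, 0), (-2, 0), (-1, 0)], 353698,
    [⟨(1, 0), (1, 0), (0, 1), 53, 631⟩, ⟨(0, -1), (1, 0), (0, -1), 75, 577⟩,
     ⟨(0, 1), (1, 0), (0, 1), 75, 577⟩]⟩,
   ⟨[(-4, -2), (-4, -1), (-4, 0), (-3, -2), (-2, -2), (-1, -2), (0, -2), (0, -1), (1, -2)], 306499,
    [⟨(0, 1), (0, 1), (1, 0), 9, 657⟩, ⟨(1, 0), (1, 0), (0, 1), 47, 599⟩,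
     ⟨(-1, 0), (1, 0), (0, 1), 76, 509⟩]⟩,
   ⟨[(-3, -2), (-3, -1), (-3, 0), (-3, 1), (-2, -1), (-1, -1), (0, -1), (1, -1), (1, 0), (1, 1), (2, -1)], 160571,
    [⟨(0, 1), (1, 0), (0, 1), 77, 732⟩, ⟨(-1, 0), (1, 0), (0, 1), 36, 604⟩]⟩,
   ⟨[(-4, -1), (-3, -1), (-3, 0), (-2, -1), (-2, 0), (-2, 1), (-1, -1), (-1, 0)], 322218,
    [⟨(1, 0), (1, 0), (0, 1), 12, 645⟩, ⟨(0, 1), (1, 0), (0, 1), 10, 581⟩,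
     ⟨(0, -1), (1, 0), (0, -1), 78, 554⟩]⟩,
   ⟨[(-3, -3), (-3, -2), (-3, -1), (-3, 0), (-3, 1), (-2, -3), (-2, 0), (-1, -3), (-1, 0)], 323242,
    [⟨(1, 0), (1, 0), (0, 1), 68, 648⟩, ⟨(0, -1), (1, 0), (0, 1), 79, 537⟩,
     ⟨(0, 1), (1, 0), (0, 1), 16, 591⟩]⟩,
   ⟨[(-2, -2), (-2, -1), (-2, 0), (-2, 1), (-2, 2), (-1, -2), (-1, 1), (0, -2), (0, 2), (1, 1)], 191730,
    [⟨(-1, 0), (0, 1), (1, 0), 70, 372⟩, ⟨(0, 1), (1, 0), (0, 1), 3, 6⟩,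
     ⟨(1, 0), (1, 0), (0, -1), 80, 723⟩, ⟨(0, -1), (1, 0), (0, -1), 81, 555⟩]⟩,
   ⟨[(-3, -2), (-2, -2), (-2, -1), (-2, 0), (-2, 1), (-2, 2), (-1, -2), (-1, 0), (-1, 1), (0, -2), (0, 1)], 205307,
    [⟨(1, 0), (1, 0), (0, 1), 71, 754⟩, ⟨(0, -1), (1, 0), (0, -1), 81, 548⟩]⟩,
   ⟨[(-2, 0), (-1, -1), (-1, 1), (0, -1), (1, 0), (1, 1)], 95775,
    [⟨(-1, 0), (1, 0), (0, 1), 3, 13⟩, ⟨(0, 1), (0, 1), (1, 0), 82, 807⟩]⟩,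
   ⟨[(-4, -1), (-4, 0), (-4, 1), (-3, -1), (-3, 0), (-2, -1), (-2, 0), (-1, -1), (-1, 0), (0, -2), (1, -1)], 241203,
    [⟨(0, -1), (1, 0), (0, 1), 3, 5⟩, ⟨(0, 1), (1, 0), (0, 1), 83, 701⟩,
     ⟨(1, 0), (1, 0), (0, 1), 4, 656⟩]⟩,
   ⟨[(-3, -1), (-2, -1), (-1, -1), (-1, 0), (-1, 1), (-1, 2), (0, -1), (0, 1), (1, 1)], 137600,
    [⟨(1, 0), (1, 0), (0, 1), 84, 807⟩]⟩,
   ⟨[(-4, -1), (-3, -1), (-3, 0), (-3, 1), (-3, 2), (-2, -1), (-2, 1), (-1, 1), (0, 2), (1, 1)], 248333,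
    [⟨(0, 1), (1, 0), (0, 1), 3, 4⟩, ⟨(0, -1), (1, 0), (0, -1), 85, 677⟩,
     ⟨(-1, 0), (1, 0), (0, -1), 60, 362⟩, ⟨(1, 0), (1, 0), (0, -1), 4, 640⟩]⟩,
   ⟨[(-4, -1), (-3, -1), (-3, 0), (-3, 1), (-2, -1), (-2, 0), (-2, 1), (-1, 0), (-1, 1), (0, 1)], 262576,
    [⟨(1, 0), (1, 0), (0, -1), 86, 705⟩, ⟨(0, -1), (1, 0), (0, -1), 23, 650⟩]⟩,
   ⟨[(-3, -2), (-3, -1), (-3, 0), (-3, 1), (-3, 2), (-2, -1), (-2, 0), (-1, -1), (-1, 0)], 319899,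
    [⟨(1, 0), (1, 0), (0, 1), 87, 647⟩, ⟨(0, -1), (1, 0), (0, -1), 88, 554⟩,
     ⟨(0, 1), (1, 0), (0, 1), 18, 579⟩]⟩,
   ⟨[(-3, -1), (-2, -2), (-2, -1), (-1, -2), (-1, -1), (0, -2), (1, -2), (1, -1), (1, 0), (1, 1), (2, -2)], 208505,
    [⟨(0, -1), (1, 0), (0, 1), 3, 5⟩, ⟨(0, 1), (0, 1), (-1, 0), 89, 706⟩,
     ⟨(-1, 0), (-1, 0), (0, 1), 90, 648⟩]⟩,
   ⟨[(-4, -1), (-3, -1), (-3, 0), (-2, -1), (-2, 1), (-1, -1), (0, -2), (1, -1)], 261341,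
    [⟨(0, -1), (1, 0), (0, 1), 3, 4⟩, ⟨(0, 1), (1, 0), (0, 1), 50, 689⟩,
     ⟨(-1, 0), (1, 0), (0, 1), 60, 349⟩, ⟨(1, 0), (1, 0), (0, 1), 4, 628⟩]⟩,
   ⟨[(-4, -2), (-4, -1), (-4, 0), (-4, 1), (-3, -3), (-3, 0), (-2, 0), (-1, 0)], 342874,
    [⟨(1, 0), (1, 0), (0, 1), 32, 638⟩, ⟨(0, -1), (1, 0), (0, -1), 91, 565⟩,
     ⟨(0, 1), (1, 0), (0, 1), 31, 580⟩]⟩,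
   ⟨[(-3, -2), (-3, -1), (-3, 0), (-3, 1), (-2, -2), (-2, 1), (-1, 1), (0, 1), (1, 1)], 253120,
    [⟨(0, -1), (1, 0), (0, -1), 92, 680⟩, ⟨(-1, 0), (1, 0), (0, 1), 93, 355⟩,
     ⟨(1, 0), (1, 0), (0, -1), 34, 638⟩]⟩,
   ⟨[(-2, 0), (-1, -1), (0, -1), (0, 1), (1, 0)], 75446,
    [⟨(-1, 0), (-1, 0), (0, 1), 26, 807⟩]⟩,
   ⟨[(-4, -2), (-3, -2), (-3, -1), (-3, 0), (-3, 1), (-3, 2), (-2, -2), (-2, 0), (-2, 1), (-1, 0), (-1, 1)], 313931,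
    [⟨(1, 0), (1, 0), (0, -1), 87, 652⟩, ⟨(0, 1), (1, 0), (0, 1), 88, 559⟩,
     ⟨(0, -1), (1, 0), (0, 1), 63, 566⟩]⟩,
   ⟨[(-3, -2), (-2, -2), (-1, -2), (0, -2), (1, -2), (1, -1), (1, 1), (2, -2), (2, 0)], 229515,
    [⟨(1, 0), (1, 0), (0, 1), 3, 5⟩, ⟨(-1, 0), (-1, 0), (0, 1), 95, 671⟩,
     ⟨(0, -1), (1, 0), (0, 1), 94, 294⟩, ⟨(0, 1), (0, 1), (-1, 0), 4, 663⟩]⟩,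
   ⟨[(-3, -3), (-3, -2), (-3, -1), (-2, -2), (-1, -2), (0, -2), (0, -1), (1, -2), (1, -1), (1, 0), (2, -2)], 237049,
    [⟨(0, 1), (0, 1), (1, 0), 96, 719⟩, ⟨(-1, 0), (0, 1), (1, 0), 48, 629⟩]⟩,
   ⟨[(-4, -1), (-4, 0), (-3, -1), (-2, -1), (-1, -1), (0, -1), (1, -1), (1, 0), (1, 1), (2, -1)], 189821,
    [⟨(0, 1), (1, 0), (0, 1), 97, 709⟩, ⟨(-1, 0), (1, 0), (0, 1), 98, 645⟩]⟩,
   ⟨[(-5, -1), (-4, -1), (-3, -1), (-2, -1), (-1, -1), (0, -1), (1, -1)], 291632,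
    [⟨(0, 1), (1, 0), (0, 1), 50, 655⟩, ⟨(-1, 0), (1, 0), (0, 1), 99, 523⟩,
     ⟨(1, 0), (1, 0), (0, 1), 34, 592⟩]⟩,
   ⟨[(-3, -2), (-3, -1), (-3, 0), (-2, -2), (-1, -2), (0, -2), (1, -2), (1, -1), (1, 0), (1, 1), (2, -2), (2, 0)], 198892,
    [⟨(-1, 0), (-1, 0), (0, 1), 100, 645⟩, ⟨(0, -1), (1, 0), (0, 1), 101, 157⟩,
     ⟨(0, 1), (0, 1), (-1, 0), 4, 703⟩]⟩,
   ⟨[(-3, -2), (-3, -1), (-3, 0), (-2, -2), (-1, -2), (0, -2), (0, -1), (1, -2), (1, -1), (1, 0), (2, -2)], 225485,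
    [⟨(0, 1), (0, 1), (1, 0), 96, 732⟩, ⟨(-1, 0), (0, 1), (1, 0), 58, 605⟩]⟩,
   ⟨[(-4, 0), (-3, -1), (-3, 0), (-2, -1), (-2, 0), (-1, -1), (-1, 0), (0, -2), (1, -1)], 245087,
    [⟨(0, -1), (1, 0), (0, 1), 3, 5⟩, ⟨(0, 1), (1, 0), (0, 1), 43, 704⟩,
     ⟨(1, 0), (1, 0), (0, 1), 4, 652⟩]⟩,
   ⟨[(-3, -1), (-3, 0), (-2, -2), (-2, 1), (-1, -2), (-1, 1), (0, 1), (1, 1)], 231532,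
    [⟨(-1, 0), (1, 0), (0, 1), 102, 383⟩, ⟨(0, -1), (1, 0), (0, -1), 103, 652⟩,
     ⟨(1, 0), (1, 0), (0, -1), 34, 660⟩]⟩,
   ⟨[(-3, -2), (-3, -1), (-3, 0), (-3, 1), (-3, 2), (-2, -1), (-2, 0), (-1, -1), (-1, 0), (0, -1)], 265521,
    [⟨(1, 0), (1, 0), (0, 1), 87, 708⟩, ⟨(0, 1), (1, 0), (0, 1), 18, 647⟩]⟩,
   ⟨[(-2, 0), (-1, -1), (-1, 1), (0, -1), (0, 1), (1, -1)], 140466,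
    [⟨(-1, 0), (1, 0), (0, 1), 3, 9⟩, ⟨(1, 0), (1, 0), (0, 1), 5, 807⟩]⟩,
   ⟨[(-2, -1), (-2, 0), (-1, -2), (-1, -1), (-1, 1), (0, -1), (0, 1)], 174215,
    [⟨(-1, 0), (1, 0), (0, 1), 3, 7⟩, ⟨(1, 0), (1, 0), (0, 1), 6, 807⟩]⟩,
   ⟨[(-4, -2), (-4, -1), (-4, 0), (-3, -2), (-3, -1), (-2, -2), (-2, -1), (-1, -2), (0, -3), (0, -2), (0, -1), (1, -2)], 298363,
    [⟨(0, 1), (0, 1), (1, 0), 46, 661⟩, ⟨(-1, 0), (1, 0), (0, 1), 104, 491⟩,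
     ⟨(1, 0), (0, 1), (1, 0), 10, 605⟩]⟩,
   ⟨[(-4, -1), (-3, -1), (-2, -1), (-2, 0), (-2, 1), (-2, 2), (-1, -1), (-1, 1), (0, 1)], 250308,
    [⟨(-1, 0), (1, 0), (0, 1), 3, 4⟩, ⟨(1, 0), (1, 0), (0, 1), 105, 709⟩,
     ⟨(0, -1), (1, 0), (0, -1), 11, 644⟩]⟩,
   ⟨[(-4, 0), (-3, -2), (-3, -1), (-3, 0), (-2, -2), (-2, 0), (-1, -2), (0, -3), (0, -2), (0, -1), (1, -2)], 286896,
    [⟨(0, 1), (0, 1), (1, 0), 57, 667⟩, ⟨(-1, 0), (0, 1), (-1, 0), 106, 454⟩,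
     ⟨(1, 0), (0, 1), (1, 0), 10, 618⟩]⟩,
   ⟨[(-4, -1), (-3, -1), (-3, 0), (-3, 1), (-2, -1), (-2, 0), (-1, -1), (-1, 0)], 330353,
    [⟨(1, 0), (1, 0), (0, 1), 24, 646⟩, ⟨(0, 1), (1, 0), (0, 1), 25, 585⟩,
     ⟨(0, -1), (1, 0), (0, -1), 78, 547⟩]⟩,
   ⟨[(-4, -2), (-4, -1), (-4, 0), (-4, 1), (-4, 2), (-3, -1), (-3, 0), (-2, -1), (-2, 0), (-1, 0)], 337707,
    [⟨(1, 0), (1, 0), (0, 1), 32, 643⟩, ⟨(0, 1), (1, 0), (0, 1), 33, 574⟩,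
     ⟨(0, -1), (1, 0), (0, -1), 107, 565⟩]⟩,
   ⟨[(-3, -1), (-3, 0), (-3, 1), (-2, -1), (-1, -1), (-1, 0), (0, -1), (1, -1)], 242573,
    [⟨(0, 1), (1, 0), (0, 1), 35, 700⟩, ⟨(1, 0), (1, 0), (0, 1), 34, 657⟩]⟩,
   ⟨[(-3, -1), (-3, 0), (-2, -1), (-2, 0), (-2, 1), (-1, -1), (-1, 0), (0, -1)], 263847,
    [⟨(1, 0), (1, 0), (0, 1), 86, 704⟩, ⟨(0, 1), (1, 0), (0, 1), 10, 652⟩]⟩,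
   ⟨[(-2, -1), (-1, -1), (-1, 0), (-1, 1), (0, -1), (1, -1), (2, -1)], 209410,
    [⟨(0, 1), (0, 1), (1, 0), 108, 693⟩, ⟨(1, 0), (1, 0), (0, 1), 109, 665⟩]⟩,
   ⟨[(-4, -2), (-4, -1), (-4, 0), (-4, 1), (-3, -1), (-3, 2), (-2, -1), (-1, -1), (0, -1), (1, -1)], 270702,
    [⟨(0, 1), (1, 0), (0, 1), 54, 668⟩, ⟨(-1, 0), (1, 0), (0, 1), 110, 454⟩,
     ⟨(1, 0), (1, 0), (0, 1), 34, 616⟩]⟩,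
   ⟨[(-3, -2), (-3, -1), (-3, 0), (-3, 1), (-2, -2), (-2, 1), (-1, -2), (0, -2), (0, -1), (1, -2)], 296076,
    [⟨(0, 1), (0, 1), (1, 0), 111, 650⟩, ⟨(1, 0), (1, 0), (0, 1), 47, 608⟩,
     ⟨(-1, 0), (0, 1), (1, 0), 58, 508⟩]⟩,
   ⟨[(-2, -1), (-2, 0), (-1, -2), (-1, 1), (0, 1), (1, -1), (1, 0), (1, 1)], 94966,
    [⟨(-1, 0), (0, 1), (1, 0), 70, 588⟩, ⟨(0, -1), (1, 0), (0, -1), 26, 740⟩]⟩,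
   ⟨[(-3, -1), (-2, -1), (-1, -1), (-1, 1), (0, -1), (0, 1), (1, 0)], 67940,
    [⟨(-1, 0), (1, 0), (0, 1), 112, 807⟩]⟩,
   ⟨[(-3, -2), (-2, -2), (-2, -1), (-2, 0), (-2, 1), (-1, -2), (-1, 0), (0, -2), (1, -2), (2, -2)], 256894,
    [⟨(0, -1), (-1, 0), (0, 1), 112, 423⟩, ⟨(0, 1), (0, 1), (-1, 0), 113, 668⟩,
     ⟨(1, 0), (0, 1), (1, 0), 114, 630⟩]⟩,
   ⟨[(-3, -3), (-3, -2), (-3, -1), (-3, 0), (-3, 1), (-3, 2), (-2, -3), (-2, 0), (-2, 1), (-1, 0), (-1, 1)], 315651,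
    [⟨(1, 0), (1, 0), (0, -1), 87, 650⟩, ⟨(0, -1), (1, 0), (0, 1), 69, 570⟩,
     ⟨(0, 1), (1, 0), (0, 1), 88, 558⟩]⟩,
   ⟨[(-4, -2), (-3, -2), (-2, -2), (-1, -2), (0, -2), (0, -1), (1, -2), (1, -1), (1, 0), (2, -2)], 242678,
    [⟨(0, 1), (0, 1), (-1, 0), 65, 716⟩, ⟨(-1, 0), (1, 0), (0, 1), 72, 633⟩]⟩,
   ⟨[(-3, -1), (-3, 0), (-2, -1), (-1, -1), (0, -1), (1, -1), (1, 1), (2, -1), (2, 0), (2, 1)], 187942,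
    [⟨(1, 0), (1, 0), (0, 1), 3, 6⟩, ⟨(0, 1), (0, 1), (-1, 0), 108, 720⟩,
     ⟨(-1, 0), (-1, 0), (0, -1), 115, 627⟩]⟩,
   ⟨[(-4, -1), (-3, -1), (-2, -1), (-1, -1), (0, -1), (1, -1), (1, 0), (1, 1), (2, -1)], 198890,
    [⟨(0, 1), (1, 0), (0, 1), 97, 697⟩, ⟨(-1, 0), (-1, 0), (0, 1), 90, 660⟩]⟩,
   ⟨[(-3, -2), (-3, 0), (-2, -1), (-2, 0), (-2, 1), (-1, -2), (-1, 0), (0, -2), (1, -2), (2, -2), (2, -1), (2, 0)], 198400,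
    [⟨(0, -1), (-1, 0), (0, 1), 116, 274⟩, ⟨(0, 1), (0, 1), (-1, 0), 113, 739⟩,
     ⟨(1, 0), (0, 1), (1, 0), 81, 551⟩]⟩,
   ⟨[(-3, -1), (-3, 0), (-3, 1), (-2, -1), (-1, -1), (-1, 1), (0, -1), (0, 1), (1, -1), (1, 0), (2, 1)], 28947,
    [⟨(-1, 0), (1, 0), (0, 1), 116, 807⟩]⟩,
   ⟨[(-2, -1), (-2, 0), (-1, -2), (-1, 1), (0, -2), (0, 1), (1, 0)], 96520,
    [⟨(-1, 0), (0, 1), (1, 0), 70, 583⟩, ⟨(0, -1), (1, 0), (0, -1), 81, 741⟩]⟩,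
   ⟨[(-3, -1), (-3, 0), (-2, -2), (-2, 1), (-1, -2), (-1, -1), (-1, 1), (0, -2), (0, -1), (1, -2)], 244530,
    [⟨(-1, 0), (1, 0), (0, -1), 70, 305⟩, ⟨(1, 0), (1, 0), (0, 1), 117, 682⟩,
     ⟨(0, 1), (0, 1), (1, 0), 19, 648⟩]⟩,
   ⟨[(-3, -2), (-3, -1), (-3, 0), (-2, -1), (-1, -1), (0, -2), (1, -2), (1, -1), (1, 0), (1, 1)], 181870,
    [⟨(0, -1), (1, 0), (0, 1), 3, 6⟩, ⟨(0, 1), (1, 0), (0, 1), 118, 721⟩,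
     ⟨(-1, 0), (1, 0), (0, 1), 30, 625⟩]⟩,
   ⟨[(-4, -1), (-3, -1), (-3, 0), (-3, 1), (-3, 2), (-2, -1), (-2, 0), (-2, 1), (-1, 0), (-1, 1)], 320231,
    [⟨(1, 0), (1, 0), (0, -1), 12, 646⟩, ⟨(0, 1), (1, 0), (0, 1), 88, 553⟩,
     ⟨(0, -1), (1, 0), (0, -1), 23, 580⟩]⟩,
   ⟨[(-2, -2), (-2, 0), (-1, -1), (-1, 2), (0, -1), (0, 1), (1, -1)], 154151,
    [⟨(-1, 0), (0, -1), (-1, 0), 70, 457⟩, ⟨(1, 0), (1, 0), (0, 1), 5, 776⟩]⟩,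
   ⟨[(-4, -1), (-4, 0), (-4, 1), (-3, -1), (-3, 0), (-2, -1), (-2, 0), (-1, -1), (0, -2), (1, -1)], 266294,
    [⟨(0, -1), (1, 0), (0, 1), 3, 4⟩, ⟨(0, 1), (1, 0), (0, 1), 83, 666⟩,
     ⟨(1, 0), (1, 0), (0, 1), 5, 624⟩, ⟨(-1, 0), (-1, 0), (0, 1), 26, 442⟩]⟩,
   ⟨[(-2, -2), (-2, -1), (-2, 0), (-2, 1), (-2, 2), (-1, -1), (-1, 0), (0, -1)], 251391,
    [⟨(1, 0), (1, 0), (0, 1), 65, 708⟩, ⟨(0, 1), (1, 0), (0, 1), 114, 646⟩]⟩,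
   ⟨[(-2, -1), (-2, 0), (-2, 1), (-1, -1), (-1, 1), (0, -1), (1, -1)], 224814,
    [⟨(-1, 0), (1, 0), (0, 1), 3, 5⟩, ⟨(1, 0), (1, 0), (0, 1), 89, 688⟩,
     ⟨(0, 1), (1, 0), (0, 1), 11, 672⟩]⟩,
   ⟨[(-3, -2), (-3, -1), (-3, 0), (-3, 1), (-2, -1), (-2, 2), (-1, -1), (0, -1), (1, -1), (1, 0), (1, 1), (2, -1)], 145362,
    [⟨(0, 1), (1, 0), (0, 1), 77, 758⟩, ⟨(-1, 0), (1, 0), (0, -1), 93, 535⟩]⟩,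
   ⟨[(-3, -3), (-3, -2), (-3, -1), (-3, 0), (-3, 1), (-2, -3), (-2, 0), (-1, -3), (-1, 0), (0, -3)], 315897,
    [⟨(1, 0), (1, 0), (0, 1), 68, 655⟩, ⟨(0, -1), (1, 0), (0, 1), 119, 515⟩,
     ⟨(0, 1), (1, 0), (0, 1), 16, 598⟩]⟩,
   ⟨[(-2, -1), (-1, -1), (0, -1), (0, 1), (1, -1), (1, 1), (2, 0)], 123589,
    [⟨(1, 0), (1, 0), (0, 1), 3, 10⟩, ⟨(-1, 0), (-1, 0), (0, 1), 109, 807⟩]⟩,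
   ⟨[(-3, -2), (-3, -1), (-3, 0), (-3, 1), (-2, 0), (-1, 0), (-1, 1), (0, 2)], 289745,
    [⟨(1, 0), (1, 0), (0, 1), 17, 682⟩, ⟨(0, -1), (1, 0), (0, -1), 18, 613⟩,
     ⟨(0, 1), (0, 1), (1, 0), 26, 419⟩]⟩,
   ⟨[(-2, -2), (-2, -1), (-2, 0), (-2, 1), (-1, -1), (0, -1), (1, -1)], 250539,
    [⟨(0, 1), (0, 1), (1, 0), 117, 674⟩, ⟨(1, 0), (1, 0), (0, 1), 5, 644⟩,
     ⟨(-1, 0), (-1, 0), (0, 1), 60, 359⟩]⟩,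
   ⟨[(-3, -1), (-2, 1), (-1, -1), (-1, 0), (-1, 1), (0, 1), (1, 1), (2, 0), (2, 1)], 173587,
    [⟨(0, -1), (0, -1), (1, 0), 108, 740⟩, ⟨(1, 0), (1, 0), (0, -1), 26, 586⟩]⟩,
   ⟨[(-2, -1), (-2, 0), (-2, 1), (-1, -1), (0, -1), (0, 1), (1, -1), (1, 1), (2, 0)], 52658,
    [⟨(1, 0), (1, 0), (0, 1), 3, 24⟩, ⟨(-1, 0), (-1, 0), (0, 1), 60, 807⟩]⟩,
   ⟨[(-3, -2), (-2, -2), (-2, -1), (-2, 0), (-2, 1), (-1, -2), (-1, 0), (0, -2)], 286433,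
    [⟨(1, 0), (1, 0), (0, 1), 39, 673⟩, ⟨(0, -1), (1, 0), (0, -1), 81, 428⟩,
     ⟨(0, 1), (0, 1), (1, 0), 38, 620⟩]⟩,
   ⟨[(-3, -3), (-3, -2), (-3, -1), (-2, -2), (-1, -2), (0, -2), (0, -1), (1, -2), (1, 0)], 244090,
    [⟨(0, 1), (0, 1), (1, 0), 46, 723⟩, ⟨(-1, 0), (0, 1), (1, 0), 48, 621⟩]⟩,
   ⟨[(-3, -1), (-3, 0), (-3, 1), (-2, -2), (-2, 1), (-1, -2), (-1, 1), (0, -2), (0, 1), (1, 1)], 209472,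
    [⟨(-1, 0), (1, 0), (0, 1), 102, 411⟩, ⟨(0, -1), (1, 0), (0, 1), 120, 611⟩,
     ⟨(1, 0), (1, 0), (0, -1), 34, 685⟩]⟩,
   ⟨[(-3, 0), (-2, -1), (-1, -1), (-1, 1), (0, -1), (0, 1)], 189882,
    [⟨(-1, 0), (1, 0), (0, 1), 70, 400⟩, ⟨(1, 0), (1, 0), (0, 1), 7, 785⟩]⟩]

theorem patternTable_isValid :
    ∀ p ∈ patternTable, p.isValid patternTable (24801 / 10000) (9998 / 10000) = true := by
  decide +kernel

end HardCore

namespace HardCore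

section Vacancy

variable {V : Type*} {G : SimpleGraph V}

theorem abs_exp_neg_sub_exp_neg_le {x y : ℝ} (hx : 0 ≤ x) (hy : 0 ≤ y) :
    |Real.exp (-x) - Real.exp (-y)| ≤ |x - y| := by
  wlog hxy : x ≤ y generalizing x y
  · rw [abs_sub_comm, abs_sub_comm x]
    exact this hy hx (le_of_not_ge hxy)
  have h1 : Real.exp (-y) ≤ Real.exp (-x) := Real.exp_le_exp.2 (neg_le_neg hxy)
  rw [abs_of_nonneg (sub_nonneg.2 h1), abs_sub_comm, abs_of_nonneg (sub_nonneg.2 hxy)]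
  have h2 := Real.add_one_le_exp (x - y)
  have h3 : Real.exp (-y) = Real.exp (-x) * Real.exp (x - y) := by
    rw [← Real.exp_add]; ring_nf
  have h4 : Real.exp (-x) ≤ 1 := Real.exp_le_one_iff.2 (neg_nonpos.2 hx)
  rw [h3]
  nlinarith [Real.exp_pos (-x)]

theorem abs_log_cosh_sub_log_cosh_le (x y : ℝ) :
    |Real.log (Real.cosh x) - Real.log (Real.cosh y)| ≤ |x - y| := by
  have h : ∀ z ∈ (Set.univ : Set ℝ),
      HasDerivWithinAt (fun z => Real.log (Real.cosh z)) (Real.sinh z / Real.cosh z)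
        Set.univ z := fun z _ =>
    ((Real.hasDerivAt_cosh z).log (Real.cosh_pos z).ne').hasDerivWithinAt
  have := convex_univ.norm_image_sub_le_of_norm_hasDerivWithin_le (C := 1) h (fun z _ => by
    rw [← Real.tanh_eq_sinh_div_cosh]
    exact (Real.abs_tanh_lt_one z).le) (Set.mem_univ y) (Set.mem_univ x)
  simpa using this

/-- The vacancy probability of a finite set depends continuously on the angles. -/
theorem abs_Z_div_Z_sub_le [DecidableEq V] {lam : ℝ} (hlam : 0 ≤ lam) (us : List V)
    (A B : Finset V) {δ : ℝ}
    (h : ∀ i : Fin us.length, |angle G lam (A \ (us.take i).toFinset) us[i] -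
      angle G lam (B \ (us.take i).toFinset) us[i]| ≤ δ) :
    |Z G lam (A \ us.toFinset) / Z G lam A - Z G lam (B \ us.toFinset) / Z G lam B| ≤
      2 * us.length * δ := by
  set L : Finset V → ℝ := fun A => ∑ i : Fin us.length,
    2 * Real.log (Real.cosh (angle G lam (A \ (us.take i).toFinset) us[i])) with hL
  have hL0 : ∀ A, 0 ≤ L A := fun A => Finset.sum_nonneg fun i _ =>
    mul_nonneg zero_le_two (Real.log_nonneg (Real.one_le_cosh _))
  have hZ : ∀ A, Z G lam (A \ us.toFinset) / Z G lam A = Real.exp (-L A) := by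
    intro A
    have hprod : ∏ i : Fin us.length, invVacancy G lam (A \ (us.take i).toFinset) us[i] =
        Real.exp (L A) := by
      rw [hL, Real.exp_sum]
      refine Finset.prod_congr rfl fun i _ => ?_
      rw [← cosh_angle_sq hlam, two_mul, Real.exp_add, Real.exp_log (Real.cosh_pos _), sq]
    rw [Z_eq_mul_prod hlam us A, hprod, Real.exp_neg, div_mul_eq_div_div,
      div_self (Z_pos hlam _).ne', one_div]
  rw [hZ, hZ]
  refine (abs_exp_neg_sub_exp_neg_le (hL0 A) (hL0 B)).trans ?_
  rw [hL, ← Finset.sum_sub_distrib]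
  refine (Finset.abs_sum_le_sum_abs _ _).trans ?_
  have : ∑ _i : Fin us.length, 2 * δ = 2 * us.length * δ := by
    rw [Finset.sum_const, Finset.card_univ, Fintype.card_fin, nsmul_eq_mul]; ring
  rw [← this]
  refine Finset.sum_le_sum fun i _ => ?_
  rw [← mul_sub, abs_mul, abs_of_pos (zero_lt_two' ℝ)]
  exact mul_le_mul_of_nonneg_left ((abs_log_cosh_sub_log_cosh_le _ _).trans (h i)) zero_le_two

/-- The finite-volume probability that `F` is vacant, in terms of the partition functions of the
set `B` of those vertices of `Λ` that are not blocked by the boundary condition. -/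
theorem exists_finiteGibbs_avoid_eq [DecidableEq V] (lam : ℝ≥0) {Λ F : Finset V} (hF : F ⊆ Λ)
    (η : Set V) : ∃ B : Finset V, B ⊆ Λ ∧ (∀ v ∈ Λ, (∀ w ∉ Λ, ¬ G.Adj v w) → v ∈ B) ∧
      finiteGibbs G lam Λ η (avoid F) = ENNReal.ofReal (Z G lam (B \ F) / Z G lam B) := by
  classical
  set B := Λ.filter fun v => ∀ w ∈ η, w ∉ Λ → ¬ G.Adj v w with hB
  have hallowed : ∀ I, I ∈ allowed G Λ η ↔ I ⊆ B ∧ G.IsIndepSet (I : Set V) := by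
    intro I
    rw [mem_allowed]
    constructor
    · rintro ⟨h1, h2, h3⟩
      exact ⟨fun v hv => Finset.mem_filter.2 ⟨h1 hv, h3 v hv⟩, h2⟩
    · rintro ⟨h1, h2⟩
      exact ⟨fun v hv => (Finset.mem_filter.1 (h1 hv)).1, h2,
        fun v hv => (Finset.mem_filter.1 (h1 hv)).2⟩
  have hpow : ∀ I : Finset V, (lam : ℝ≥0∞) ^ I.card = ENNReal.ofReal ((lam : ℝ) ^ I.card) := by
    intro I
    rw [ENNReal.ofReal_pow lam.coe_nonneg, ENNReal.ofReal_coe_nnreal]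
  have hsum : ∀ s : Finset (Finset V), ∑ I ∈ s, (lam : ℝ≥0∞) ^ I.card =
      ENNReal.ofReal (∑ I ∈ s, (lam : ℝ) ^ I.card) := by
    intro s
    rw [ENNReal.ofReal_sum_of_nonneg fun I _ => pow_nonneg lam.coe_nonneg _]
    exact Finset.sum_congr rfl fun I _ => hpow I
  refine ⟨B, Finset.filter_subset _ _, fun v hv h => Finset.mem_filter.2
    ⟨hv, fun w _ hw => h w hw⟩, ?_⟩
  have hden : partitionFunction G lam Λ η = ENNReal.ofReal (Z G lam B) := by
    rw [partitionFunction, hsum, Z]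
    congr 2
    ext I
    simp only [hallowed, Finset.mem_filter, Finset.mem_powerset]
  have hnum : ∑ I ∈ allowed G Λ η, (lam : ℝ≥0∞) ^ I.card * (avoid F).indicator 1 (glue Λ I η) =
      ENNReal.ofReal (Z G lam (B \ F)) := by
    rw [Z, ← hsum]
    have : ∀ I, (lam : ℝ≥0∞) ^ I.card * (avoid F).indicator 1 (glue Λ I η) =
        if Disjoint I F then (lam : ℝ≥0∞) ^ I.card else 0 := by
      intro I
      have hiff : glue Λ I η ∈ avoid F ↔ Disjoint I F := by
        rw [Finset.disjoint_right, mem_avoid]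
        refine forall₂_congr fun v hv => ?_
        rw [mem_glue]
        have := hF hv
        tauto
      by_cases hd : Disjoint I F
      · rw [Set.indicator_of_mem (hiff.2 hd), if_pos hd, Pi.one_apply, mul_one]
      · rw [Set.indicator_of_notMem (fun h => hd (hiff.1 h)), if_neg hd, mul_zero]
    simp only [this]
    rw [← Finset.sum_filter]
    refine Finset.sum_congr ?_ fun _ _ => rfl
    ext I
    simp only [hallowed, Finset.mem_filter, Finset.mem_powerset, Finset.subset_sdiff]
    tauto
  rw [finiteGibbs_apply (measurableSet_avoid F), hden, hnum,
    ENNReal.ofReal_div_of_pos (Z_pos lam.coe_nonneg _), div_eq_mul_inv, mul_comm]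

end Vacancy

theorem exists_abs_angle_sub_angle_le {lam : ℝ} (hlam : 0 < lam) (hlam₀ : lam ≤ 24801 / 10000) :
    ∃ C κ : ℝ, 0 ≤ κ ∧ κ < 1 ∧ ∀ (n : ℕ) (v : ℤ × ℤ) (A B : Finset (ℤ × ℤ)),
      (∀ x : ℤ × ℤ, |x.1 - v.1| + |x.2 - v.2| ≤ n → (x ∈ A ↔ x ∈ B)) →
      |angle squareLattice lam A v - angle squareLattice lam B v| ≤ C * κ ^ n := by
  have hlen : 0 < patternTable.length := by decide +kernel
  have hroot : patternTable[0].removed = [] := rfl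
  refine ⟨Real.arsinh √lam * patternTable[0].weight, ((9998 / 10000 : ℚ) : ℝ), by norm_num,
    by norm_num, fun n v A B h => ?_⟩
  have := abs_angle_sub_angle_le (κ := 9998 / 10000) (by norm_num) patternTable_isValid hlam
    (by push_cast; exact hlam₀) n patternTable[0] (List.getElem_mem _) v (1, 0) (0, 1)
    (by decide) A B (by simp [hroot]) h
  rwa [mul_right_comm] at this

theorem finite_neighborSet_squareLattice (v : ℤ × ℤ) : (squareLattice.neighborSet v).Finite := by
  refine ((List.finite_toSet [((1 : ℤ), (0 : ℤ)), (-1, 0), (0, 1), (0, -1)]).image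
    fun e => v + e).subset fun u hu => ?_
  have hu' : squareLattice.Adj v (v + (u - v)) := by simpa using hu
  exact ⟨u - v, normSq_eq_one_cases (squareLattice_adj_add_iff.1 hu'), by simp⟩

theorem uniqueness_squareLattice {lam : ℝ≥0} (hlam : 0 < lam) (hlam₀ : (lam : ℝ) ≤ 24801 / 10000) :
    Uniqueness squareLattice lam := by
  obtain ⟨C, κ, hκ0, hκ1, hdecay⟩ := exists_abs_angle_sub_angle_le (NNReal.coe_pos.2 hlam) hlam₀
  refine uniqueness_of_forall_exists finite_neighborSet_squareLattice fun F ε hε => ?_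
  rcases eq_or_ne ε ∞ with rfl | hε'
  · exact ⟨∅, fun η σ => by simp⟩
  have hεr : 0 < ε.toReal := ENNReal.toReal_pos hε.ne' hε'
  set us := F.toList with hus
  have htend : Filter.Tendsto (fun n : ℕ => 2 * us.length * (C * κ ^ n)) Filter.atTop
      (nhds (2 * us.length * (C * 0))) :=
    ((tendsto_pow_atTop_nhds_zero_of_lt_one hκ0 hκ1).const_mul C).const_mul _
  rw [mul_zero, mul_zero] at htend
  obtain ⟨n, hn⟩ := (htend.eventually (gt_mem_nhds hεr)).exists
  set m : ℤ := ∑ v ∈ F, (|v.1| + |v.2|) with hm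
  have hFm : ∀ v ∈ F, |v.1| + |v.2| ≤ m := fun v hv =>
    Finset.single_le_sum (f := fun v : ℤ × ℤ => |v.1| + |v.2|) (fun v _ => by positivity) hv
  set M : ℤ := m + n + 1 with hM
  set Λ : Finset (ℤ × ℤ) := Finset.Icc (-M, -M) (M, M) with hΛ
  have hmem : ∀ x : ℤ × ℤ, x ∈ Λ ↔ |x.1| ≤ M ∧ |x.2| ≤ M := by
    intro x
    simp only [hΛ, Finset.mem_Icc, Prod.le_def, abs_le]
    tauto
  have hFΛ : F ⊆ Λ := by
    intro v hv
    have := hFm v hv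
    have h1 := abs_nonneg v.1
    have h2 := abs_nonneg v.2
    rw [hmem]
    constructor <;> omega
  have hdeep : ∀ v ∈ F, ∀ x : ℤ × ℤ, |x.1 - v.1| + |x.2 - v.2| ≤ n →
      x ∈ Λ ∧ ∀ w ∉ Λ, ¬ squareLattice.Adj x w := by
    intro v hv x hx
    have hvm := hFm v hv
    have e1 := abs_add_le (x.1 - v.1) v.1
    have e2 := abs_add_le (x.2 - v.2) v.2
    rw [sub_add_cancel] at e1 e2
    have h1 := abs_nonneg v.1
    have h2 := abs_nonneg v.2
    have h3 := abs_nonneg (x.1 - v.1)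
    have h4 := abs_nonneg (x.2 - v.2)
    refine ⟨(hmem x).2 ⟨by omega, by omega⟩, fun w hw hxw => hw ((hmem w).2 ?_)⟩
    have hxw : |x.1 - w.1| + |x.2 - w.2| = 1 := hxw
    have f1 := abs_sub_abs_le_abs_sub w.1 x.1
    have f2 := abs_sub_abs_le_abs_sub w.2 x.2
    rw [abs_sub_comm] at f1 f2
    have g1 := abs_nonneg (x.1 - w.1)
    have g2 := abs_nonneg (x.2 - w.2)
    constructor <;> omega
  refine ⟨Λ, fun η σ => ?_⟩
  obtain ⟨A, hAΛ, hA, hAeq⟩ := exists_finiteGibbs_avoid_eq (G := squareLattice) lam hFΛ η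
  obtain ⟨B, hBΛ, hB, hBeq⟩ := exists_finiteGibbs_avoid_eq (G := squareLattice) lam hFΛ σ
  have hle := abs_Z_div_Z_sub_le (G := squareLattice) lam.coe_nonneg us A B (δ := C * κ ^ n) fun i => by
    refine hdecay n us[i] _ _ fun x hx => ?_
    have hi : us[i] ∈ F := Finset.mem_toList.1 (List.getElem_mem _)
    obtain ⟨hx1, hx2⟩ := hdeep _ hi x hx
    simp only [Finset.mem_sdiff, hA x hx1 hx2, hB x hx1 hx2]
  rw [hus, Finset.toList_toFinset, ← hus] at hle
  rw [hAeq, hBeq, ← ENNReal.ofReal_toReal hε', ← ENNReal.ofReal_add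
    (div_nonneg (Z_pos lam.coe_nonneg _).le (Z_pos lam.coe_nonneg _).le) hεr.le]
  refine ENNReal.ofReal_le_ofReal ?_
  have := (abs_le.1 (hle.trans hn.le)).2
  linarith

end HardCore

theorem theorem2 :
    ((2.48 : ℝ≥0) : ℝ≥0∞) < HardCore.criticalActivity squareLattice := by
  have h : ((2.48 : ℝ≥0) : ℝ≥0∞) < ((2.4801 : ℝ≥0) : ℝ≥0∞) := by
    rw [ENNReal.coe_lt_coe, ← NNReal.coe_lt_coe]
    push_cast
    norm_num
  refine h.trans_le (le_iInf fun lam => le_iInf fun hlam => le_iInf fun hnot => ?_)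
  by_contra hlt
  refine hnot (HardCore.uniqueness_squareLattice hlam ?_)
  have hlt := ENNReal.coe_lt_coe.1 (not_le.1 hlt)
  rw [← NNReal.coe_lt_coe] at hlt
  push_cast at hlt
  norm_num at hlt ⊢
  exact hlt.le
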